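/- Setting. Let $G=(V,E,w)$ be a finite connected graph with positive edge weights, $n=|V|$, in which any two distinct nodes are at distance at least $1$; let $D$ be its diameter and $N_r(v)$ the set of nodes at distance at most $r$ from $v$. The doubling dimension of $G$ is the least $\delta$ such that every ball $N_r(v)$ is covered by at most $2^\delta$ balls of radius $r/2$. An $(r,\sigma,I)$-partition is a partition of $V$ into clusters of diameter at most $r\sigma$ such that every $N_r(v)$ meets at most $I$ clusters. A $(\sigma,I)$-partition hierarchy ($\sigma\ge 1$, $\rho=4\sigma$, $h=\lceil\log_\rho D\rceil$; $h=0$ if $D=0$) consists of an $(r_l,\sigma,I)$-partition $\mathcal P_l$ with $r_l=\min(D,\rho^l)$ for each level $0\le l\le h$, where $\mathcal P_h=\{V\}$, together with a leader chosen in every cluster. The nodes of $G$ are the leaves of a tree: the parent of a node is its cluster in $\mathcal P_0$, and the parent of a cluster of level $l<h$ is the cluster of level $l+1$ that contains its leader. A universal TSP tour induced by the hierarchy is the order of all nodes in a depth-first traversal of this tree; a subset $S'\subseteq V$ is toured in this order, returning from the last node to the first. Model. One object is initially at a node $v'$, and each node of a set $\mathcal T\subseteq V$ holds exactly one transaction.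 In a schedule the object follows a walk from $v'$, and each transaction follows a walk from its node to a node visited by the object, where it is executed. The cost is $\alpha$ times the length of the object's walk plus $\beta$ times the total length of the transactions' walks, where $\alpha>\beta>0$. $C^*$ is the optimal cost. Algorithm GlobalAware\_SingleObj. Put $\gamma=\lceil\alpha/\beta\rceil$. For $l=0,\dots,h$ in turn, for every cluster $X\in\mathcal P_l$ that contains at least $2\gamma$ transactions not yet assigned, assign all of these to the leader of $X$ (their dedicated super-leader, of level $l$). Let $R$ be the set of levels $l$ at which at least $8I\alpha/\beta$ transactions were assigned, and let $S_f$ be the set of the dedicated super-leaders of the levels in $R$. Every transaction assigned at a level in $R$ moves to its dedicated super-leader, every other transaction moves to $v'$, and the object makes a closed tour of $S_f\cup\{v'\}$ from $v'$; all moves are along shortest paths. Statement. For every $\delta$ there are $\sigma\ge 1$ and $I$ such that every such $G$ of doubling dimension at most $\delta$ has a $(\sigma,I)$-partition hierarchy. Moreover, for all $\delta$, $\sigma\geq 1$ and $I$ there is a constant $K>0$ such that for every such $G$ of doubling dimension at most $\delta$ and every $(\sigma,I)$-partition hierarchy of $G$: a universal TSP tour induced by the hierarchy exists, and for every such tour,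 (i) for every $S'\subseteq V$, the tour of $S'$ in the induced order has length at most $K\log n$ times that of an optimal TSP tour of $S'$ (with respect to the distances of $G$); (ii) for all $\alpha>\beta>0$, $v'$ and $\mathcal T$, the schedule that GlobalAware\_SingleObj produces when the object tours $S_f\cup\{v'\}$ in the induced order has cost at most $K\cdot\log n\cdot\log(1+D)\cdot C^*$. In particular, for $D\ge 2$ it is an $O(\log n\cdot\log D)$-approximation. -/

import Mathlib

universe u

noncomputable section

/-- A connected graph with positive edge weights. -/
structure WeightedGraph (V : Type u) where
  graph : SimpleGraph V
  w : Sym2 V → ℝ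
  connected : graph.Connected
  w_pos : ∀ e ∈ graph.edgeSet, 0 < w e

namespace WeightedGraph

variable {V : Type u} (G : WeightedGraph V)

/-- The length of a walk: the sum of the weights of its edges, with multiplicity. -/
def len {u v : V} (p : G.graph.Walk u v) : ℝ := (p.edges.map G.w).sum

/-- The distance: the least length of a walk (it is attained, see `exists_shortest`). -/
def dist (u v : V) : ℝ := ⨅ p : G.graph.Walk u v, G.len p

/-- `N_y(v)`: the nodes at distance at most `y` from `v`. -/
def nbhd (y : ℝ) (v : V) : Set V := {u | G.dist v u ≤ y}

/-- The diameter. -/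
def diam : ℝ := ⨆ p : V × V, G.dist p.1 p.2

/-- Every ball of radius `r` is covered by at most `2 ^ δ` balls of radius `r / 2`. -/
def Doubling (δ : ℝ) : Prop :=
  ∀ (v : V) (r : ℝ), ∃ s : Finset V, (s.card : ℝ) ≤ (2 : ℝ) ^ δ ∧
    G.nbhd r v ⊆ ⋃ c ∈ s, G.nbhd (r / 2) c

/-- The doubling dimension. -/
def doublingDim : ℝ := sInf {δ : ℝ | G.Doubling δ}

theorem len_nonneg {u v : V} (p : G.graph.Walk u v) : 0 ≤ G.len p := by
  apply List.sum_nonneg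
  intro x hx
  obtain ⟨e, he, rfl⟩ := List.mem_map.1 hx
  exact (G.w_pos e (p.edges_subset_edgeSet he)).le

theorem len_append {u v z : V} (p : G.graph.Walk u v) (q : G.graph.Walk v z) :
    G.len (p.append q) = G.len p + G.len q := by
  simp [len, SimpleGraph.Walk.edges_append]

theorem len_bypass_le [DecidableEq V] {u v : V} (p : G.graph.Walk u v) :
    G.len p.bypass ≤ G.len p := by
  have hsub : p.bypass.edges.Subperm p.edges :=
    List.subperm_of_subset p.bypass_isPath.isTrail.edges_nodup p.edges_bypass_subset_edges
  obtain ⟨l, hl, hl'⟩ := hsub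
  unfold len
  rw [← (hl.map G.w).sum_eq]
  apply (hl'.map G.w).sum_le_sum
  intro x hx
  obtain ⟨e, he, rfl⟩ := List.mem_map.1 hx
  exact (G.w_pos e (p.edges_subset_edgeSet he)).le

theorem exists_shortest [Fintype V] (u v : V) :
    ∃ p : G.graph.Walk u v, G.len p = G.dist u v := by
  classical
  have : Nonempty (G.graph.Path u v) := ⟨(G.connected u v).some.toPath⟩
  obtain ⟨p, hp⟩ := Finite.exists_min (fun p : G.graph.Path u v => G.len p.1)
  have : Nonempty (G.graph.Walk u v) := ⟨p.1⟩
  refine ⟨p.1, le_antisymm (le_ciInf fun q => ?_) (ciInf_le ⟨0, ?_⟩ p.1)⟩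
  · exact (hp q.toPath).trans (G.len_bypass_le q)
  · rintro _ ⟨q, rfl⟩
    exact G.len_nonneg q

/-- A shortest walk between two nodes. -/
def shortest [Fintype V] (u v : V) : G.graph.Walk u v := (G.exists_shortest u v).choose

theorem len_shortest [Fintype V] (u v : V) : G.len (G.shortest u v) = G.dist u v :=
  (G.exists_shortest u v).choose_spec

/-- The walk from `u` through the nodes of a list, in order, and then to `z`,
along shortest walks. -/
def through [Fintype V] : (u : V) → List V → (z : V) → G.graph.Walk u z
  | u, [], z => G.shortest u z
  | u, x :: l, z => (G.shortest u x).append (through x l z)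

theorem mem_support_through [Fintype V] (l : List V) :
    ∀ (u z : V), ∀ x ∈ l, x ∈ (G.through u l z).support := by
  induction l with
  | nil => simp
  | cons y l ih =>
    intro u z x hx
    rw [through, SimpleGraph.Walk.mem_support_append_iff]
    rcases List.mem_cons.1 hx with rfl | hx
    · exact Or.inl (SimpleGraph.Walk.end_mem_support _)
    · exact Or.inr (ih y z x hx)

/-- The distance covered by moving from `u` through the nodes of a list and then to `z`. -/
def throughLength : V → List V → V → ℝ
  | u, [], z => G.dist u z
  | u, x :: l, z => G.dist u x + throughLength x l z

/-- The length of the closed tour that visits the nodes of a list in order and then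
returns from the last node to the first one. -/
def tourLength : List V → ℝ
  | [] => 0
  | x :: l => G.throughLength x l x

/-- The length of an optimal TSP tour of the node set `S` in the complete graph on `S` weighted
by the distances of `G`. -/
def tspOpt [DecidableEq V] (S : Finset V) : ℝ :=
  ⨅ l : {l : List V // l.Nodup ∧ l.toFinset = S}, G.tourLength l.1

/-! ### Schedules -/

/-- A schedule in the dual-flow model for one object, initially at `home`, and a set `T` of
transactions, at most one per node, each named after the node that initially holds it. The object
follows a walk from `home`; each transaction follows a walk to a node visited by the object, where
it is executed. Transactions that meet the object at one node are executed one after another. -/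
structure Schedule (home : V) (T : Finset V) where
  last : V
  objWalk : G.graph.Walk home last
  meet : {t // t ∈ T} → V
  txWalk : ∀ t : {t // t ∈ T}, G.graph.Walk t.1 (meet t)
  meet_mem : ∀ t, meet t ∈ objWalk.support

/-- The communication cost: moving the object costs `α` and moving a transaction costs `β` per
unit of length. -/
def Schedule.cost {G : WeightedGraph V} {home : V} {T : Finset V} (E : G.Schedule home T)
    (α β : ℝ) : ℝ :=
  α * G.len E.objWalk + β * ∑ t, G.len (E.txWalk t)

/-- The optimal communication cost. -/
def optCost (home : V) (T : Finset V) (α β : ℝ) : ℝ :=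
  ⨅ E : G.Schedule home T, E.cost α β

/-! ### Partition hierarchies -/

/-- The `(r, σ, I)`-partitions of the node set. -/
def IsSparsePartition [Fintype V] [DecidableEq V] (P : Finpartition (Finset.univ : Finset V))
    (r σ : ℝ) (I : ℕ) : Prop :=
  (∀ X ∈ P.parts, ∀ u ∈ X, ∀ v ∈ X, G.dist u v ≤ r * σ) ∧
  ∀ v : V, {X : Finset V | X ∈ P.parts ∧ ((X : Set V) ∩ G.nbhd r v).Nonempty}.ncard ≤ I

/-- The top level `h = ⌈log_ρ D⌉`, where `ρ = 4 σ`. -/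
def topLevel (σ : ℝ) : ℕ := ⌈Real.logb (4 * σ) G.diam⌉₊

/-- The radius `r_l = min (D, ρ ^ l)` of level `l`. -/
def radius (σ : ℝ) (l : ℕ) : ℝ := min G.diam ((4 * σ) ^ l)

/-- A partition hierarchy with a designated leader in each cluster. Only the levels `l ≤ h` are
meaningful. The trivial level `-1`, where each node is a cluster, is left implicit. -/
structure PartitionHierarchy [Fintype V] [DecidableEq V] (σ : ℝ) (I : ℕ) where
  part : ℕ → Finpartition (Finset.univ : Finset V)
  leader : ℕ → Finset V → V
  sparse : ∀ l ≤ G.topLevel σ, G.IsSparsePartition (part l) (G.radius σ l) σ I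
  top : (part (G.topLevel σ)).parts = {Finset.univ}
  leader_mem : ∀ l ≤ G.topLevel σ, ∀ X ∈ (part l).parts, leader l X ∈ X

namespace PartitionHierarchy

variable {G} [Fintype V] [DecidableEq V] {σ : ℝ} {I : ℕ} (H : G.PartitionHierarchy σ I)

/-- The cluster of level `l` that contains the node `v`. -/
def cluster (l : ℕ) (v : V) : Finset V := (H.part l).part v

/-- The ancestor of the leaf `v` in level `l` of the tree of clusters, where the parent of a
cluster is the cluster of the next level that contains its leader. -/
def ancestor : ℕ → V → Finset V
  | 0, v => H.cluster 0 v
  | l + 1, v => H.cluster (l + 1) (H.leader l (ancestor l v))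

/-- The list `L` is a universal TSP tour induced by the hierarchy: the order of the leaves
(all nodes of the graph, once each) in a depth-first traversal of the tree of clusters; that is,
the leaves below each cluster are consecutive in `L`. -/
structure IsUniversalTour (L : List V) : Prop where
  nodup : L.Nodup
  mem : ∀ v, v ∈ L
  consecutive : ∀ l ≤ G.topLevel σ, ∀ a b c : V, [a, b, c].Sublist L →
    H.ancestor l a = H.ancestor l c → H.ancestor l b = H.ancestor l a

/-! ### The algorithm `GlobalAware_SingleObj` -/

/-- The transactions among `U` whose cluster in level `l` holds at least `2 γ` transactions
of `U`. -/
def selected (γ l : ℕ) (U : Finset V) : Finset V :=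
  {t ∈ U | 2 * γ ≤ (U ∩ H.cluster l t).card}

/-- The transactions without a dedicated super-leader before level `l` is processed. -/
def unassigned (γ : ℕ) (T : Finset V) : ℕ → Finset V
  | 0 => T
  | l + 1 => unassigned γ T l \ H.selected γ l (unassigned γ T l)

/-- The transactions that receive a dedicated super-leader in level `l`; it is the leader of
their cluster in that level. -/
def assigned (γ : ℕ) (T : Finset V) (l : ℕ) : Finset V :=
  H.selected γ l (H.unassigned γ T l)

/-- The dedicated super-leaders of level `l`. -/
def superLeaders (γ : ℕ) (T : Finset V) (l : ℕ) : Finset V :=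
  (H.assigned γ T l).image fun t => H.leader l (H.cluster l t)

/-- The levels that survive the pruning, where `a` is the ratio `α / β`. -/
def keptLevels (a : ℝ) (T : Finset V) : Finset ℕ :=
  {l ∈ Finset.range (G.topLevel σ + 1) | 8 * (I : ℝ) * a ≤ ((H.assigned ⌈a⌉₊ T l).card : ℝ)}

/-- The final set of dedicated super-leaders. -/
def finalLeaders (a : ℝ) (T : Finset V) : Finset V :=
  (H.keptLevels a T).biUnion (H.superLeaders ⌈a⌉₊ T)

open Classical in
/-- The node at which transaction `t` is executed: its dedicated super-leader if it was assigned
one in a level that survives the pruning, and the initial node of the object otherwise. -/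
def destination (a : ℝ) (home : V) (T : Finset V) (t : V) : V :=
  if ht : ∃ l, l ∈ H.keptLevels a T ∧ t ∈ H.assigned ⌈a⌉₊ T l then
    H.leader (Nat.find ht) (H.cluster (Nat.find ht) t)
  else home

/-- The nodes of the final set other than `home`, in the cyclic order of the tour `L`
started at `home`. -/
def stops (L : List V) (a : ℝ) (home : V) (T : Finset V) : List V :=
  let l := L.filter (· ∈ insert home (H.finalLeaders a T))
  (l.rotate (l.idxOf home)).erase home

theorem destination_mem (L : List V) (hL : ∀ v, v ∈ L) (a : ℝ) (home : V) (T : Finset V) (t : V) :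
    H.destination a home T t = home ∨ H.destination a home T t ∈ H.stops L a home T := by
  by_cases hx : H.destination a home T t = home
  · exact Or.inl hx
  right
  unfold stops
  rw [List.mem_erase_of_ne hx]
  simp only [List.mem_rotate, List.mem_filter, decide_eq_true_eq, Finset.mem_insert]
  refine ⟨hL _, Or.inr ?_⟩
  unfold destination at hx ⊢
  split_ifs at hx ⊢ with ht
  · have h1 := Nat.find_spec ht
    exact Finset.mem_biUnion.2 ⟨_, h1.1, Finset.mem_image.2 ⟨t, h1.2, rfl⟩⟩
  · exact absurd rfl hx

/-- The schedule computed by the algorithm when the object's tour follows the order `L`. All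
moves are along shortest paths; the object makes a closed tour from `home`. -/
def globalAware (L : List V) (hL : H.IsUniversalTour L) (a : ℝ) (home : V) (T : Finset V) :
    G.Schedule home T where
  last := home
  objWalk := G.through home (H.stops L a home T) home
  meet t := H.destination a home T t.1
  txWalk t := G.shortest t.1 (H.destination a home T t.1)
  meet_mem t := by
    rcases H.destination_mem L hL.mem a home T t.1 with h | h
    · rw [h]
      exact SimpleGraph.Walk.start_mem_support _
    · exact G.mem_support_through _ _ _ _ h

end PartitionHierarchy

end WeightedGraph

end

/-! Everything is compared with an arbitrary walk `p`, covered by at most `1 + len p / s` balls of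
radius `s` (`exists_cover`). Since a ball of radius `r_l` meets at most `I` clusters of level `l`, a
short walk sees few clusters.

Tour. Let `ρ = 4σ`, and let `Λ` be the length of a walk through `S`. Leaves below a common cluster
of level `l` are at distance at most `ρ ^ (l + 1)`, and leaves of a cluster are consecutive, so the
tour of `S` changes its level-`l` ancestor at most as often as `S` has such ancestors, that is `I (1
+ 2Λ / ρ ^ l)` times. Charging each step to the last level where the ancestors of its ends differ
makes a level with `ρ ^ l ≤ Λ` cost `O(Λ)`. About `log n` levels below the scale of `Λ` matter: on
lower levels even `n` steps cost only `O(Λ)` together, and on higher ones only `O(I)` steps remain,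
each of length at most `Λ`. This is `tourLength_filter_le_len`.

Algorithm. Fix any schedule of cost `B`. Transactions assigned at level `l` were left over at level
`l - 1`, so a ball of radius `r_(l-1)` holds at most `2γI` of them. If the level survives the
pruning there are too many of them to be near a short walk; hence `r_l` times their number, weighted
by `β`, is `O(B)` (`radius_mul_card_le`, `radius_mul_card_assigned_le`). This pays for moving them
to their super-leaders, and, as every super-leader has `2γ ≥ 2α/β` of them, also for detours of the
object from its walk to the super-leaders (`exists_detour`). Each level pruned or left over has
`O(α/β)` transactions, and sending those home costs `O(B)` per level. With `O(log (1 + D))` levels,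
an optimal tour of the super-leaders and the transaction moves cost `O(log (1 + D)) B`; the
universal tour adds the factor `log n`.

Existence. Partitions come from maximal separated sets, universal tours from sorting the nodes by
their ancestors, top level first. -/

noncomputable section

namespace WeightedGraph

/-! ### Distances, and covering and extending walks. -/

section Metric

variable {V : Type u} (G : WeightedGraph V)

theorem bddBelow_len (u v : V) : BddBelow (Set.range fun p : G.graph.Walk u v => G.len p) :=
  ⟨0, by rintro _ ⟨q, rfl⟩; exact G.len_nonneg q⟩

theorem dist_le_len {u v : V} (p : G.graph.Walk u v) : G.dist u v ≤ G.len p :=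
  ciInf_le (G.bddBelow_len u v) p

theorem dist_nonneg (u v : V) : 0 ≤ G.dist u v :=
  Real.iInf_nonneg fun p => G.len_nonneg p

@[simp]
theorem dist_self (u : V) : G.dist u u = 0 := by
  refine le_antisymm ((G.dist_le_len SimpleGraph.Walk.nil).trans ?_) (G.dist_nonneg u u)
  simp [len]

theorem len_reverse {u v : V} (p : G.graph.Walk u v) : G.len p.reverse = G.len p := by
  simp [len, SimpleGraph.Walk.edges_reverse]

theorem len_cons {u v z : V} (e : G.graph.Adj u v) (p : G.graph.Walk v z) :
    G.len (SimpleGraph.Walk.cons e p) = G.w s(u, v) + G.len p := by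
  simp [len]

theorem dist_le_w {u v : V} (e : G.graph.Adj u v) : G.dist u v ≤ G.w s(u, v) := by
  refine (G.dist_le_len (SimpleGraph.Walk.cons e SimpleGraph.Walk.nil)).trans ?_
  simp [len]

theorem diam_nonneg : 0 ≤ G.diam := Real.iSup_nonneg fun p => G.dist_nonneg p.1 p.2

theorem dist_le_len_of_mem_support {u v x : V} (p : G.graph.Walk u v) (hx : x ∈ p.support) :
    G.dist u x ≤ G.len p := by
  classical
  have h := congrArg G.len (p.take_spec hx)
  rw [len_append] at h
  linarith [G.dist_le_len (p.takeUntil x hx), G.len_nonneg (p.dropUntil x hx)]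

variable [Fintype V]

theorem dist_comm (u v : V) : G.dist u v = G.dist v u := by
  have key : ∀ a b : V, G.dist a b ≤ G.dist b a := fun a b => by
    rw [← G.len_shortest b a, ← G.len_reverse]
    exact G.dist_le_len _
  exact le_antisymm (key u v) (key v u)

theorem dist_triangle (u v z : V) : G.dist u z ≤ G.dist u v + G.dist v z := by
  rw [← G.len_shortest u v, ← G.len_shortest v z, ← G.len_append]
  exact G.dist_le_len _

theorem dist_le_diam (u v : V) : G.dist u v ≤ G.diam :=
  le_ciSup (f := fun p : V × V => G.dist p.1 p.2) (Set.finite_range _).bddAbove (u, v)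

/-- The greedy cover of a walk by balls of radius `s`, with a first centre `c` given. -/
theorem exists_cover_aux {s : ℝ} {u v : V} (p : G.graph.Walk u v) :
    ∀ (c : V) (b : ℝ), G.dist c u ≤ b → b ≤ s → ∃ C : Finset V, c ∈ C ∧
      (C.card : ℝ) * s ≤ s + b + G.len p ∧ ∀ x ∈ p.support, ∃ z ∈ C, G.dist z x ≤ s := by
  classical
  induction p with
  | nil =>
    intro c b hb hs
    refine ⟨{c}, by simp, ?_, ?_⟩
    · simp [len, (G.dist_nonneg _ _).trans hb]
    · intro x hx
      simp only [SimpleGraph.Walk.support_nil, List.mem_singleton] at hx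
      exact ⟨c, by simp, by rw [hx]; exact hb.trans hs⟩
  | @cons u u' v e p ih =>
    intro c b hb hs
    rw [len_cons]
    by_cases h : b + G.w s(u, u') ≤ s
    · obtain ⟨C, hc, hcard, hC⟩ := ih c _
        (((G.dist_triangle c u u').trans (add_le_add hb (G.dist_le_w e)))) h
      refine ⟨C, hc, by linarith, fun x hx => ?_⟩
      rw [SimpleGraph.Walk.support_cons, List.mem_cons] at hx
      rcases hx with rfl | hx
      · exact ⟨c, hc, hb.trans hs⟩
      · exact hC x hx
    -- The old ball may end here, so `u'` becomes a centre. Its cost `s` is paid for by `b + w > s`,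
    -- the length used up since the old centre.
    · have hs0 : 0 ≤ s := ((G.dist_nonneg _ _).trans hb).trans hs
      obtain ⟨C, hc, hcard, hC⟩ := ih u' 0 (by simp) hs0
      refine ⟨insert c C, by simp, ?_, fun x hx => ?_⟩
      · have h1 : ((insert c C).card : ℝ) ≤ C.card + 1 := by
          exact_mod_cast Finset.card_insert_le c C
        nlinarith
      · rw [SimpleGraph.Walk.support_cons, List.mem_cons] at hx
        rcases hx with rfl | hx
        · exact ⟨c, by simp, hb.trans hs⟩
        · obtain ⟨z, hz, hzx⟩ := hC x hx
          exact ⟨z, Finset.mem_insert_of_mem hz, hzx⟩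

/-- A walk of length `w` is covered by at most `1 + w / s` balls of radius `s`. -/
theorem exists_cover {s : ℝ} (hs : 0 < s) {u v : V} (p : G.graph.Walk u v) :
    ∃ C : Finset V, (C.card : ℝ) ≤ 1 + G.len p / s ∧
      ∀ x ∈ p.support, ∃ z ∈ C, G.dist z x ≤ s := by
  obtain ⟨C, -, h, hC⟩ := G.exists_cover_aux (s := s) p u 0 (by simp) hs.le
  refine ⟨C, ?_, hC⟩
  rw [← mul_le_mul_iff_of_pos_right hs, add_mul, div_mul_cancel₀ _ hs.ne']
  linarith

/-- A closed walk is extended to visit the nodes of `F` by detours from the nodes `g x`. -/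
theorem exists_detour_walk {u : V} (p : G.graph.Walk u u) (g : V → V) (F : Finset V)
    (hg : ∀ x ∈ F, g x ∈ p.support) :
    ∃ q : G.graph.Walk u u, p.support ⊆ q.support ∧ (∀ x ∈ F, x ∈ q.support) ∧
      G.len q ≤ G.len p + ∑ x ∈ F, 2 * G.dist x (g x) := by
  classical
  induction F using Finset.induction_on with
  | empty => exact ⟨p, fun _ h => h, by simp, by simp⟩
  | insert x F hx ih =>
    obtain ⟨q, hpq, hF, hq⟩ := ih fun y hy => hg y (Finset.mem_insert_of_mem hy)
    have hy : g x ∈ q.support := hpq (hg x (Finset.mem_insert_self x F))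
    have hspec := q.take_spec hy
    refine ⟨(q.takeUntil _ hy).append (((G.shortest (g x) x).append (G.shortest x (g x))).append
      (q.dropUntil _ hy)), ?_, ?_, ?_⟩
    · intro z hz
      have hz' := hpq hz
      rw [← hspec, SimpleGraph.Walk.mem_support_append_iff] at hz'
      simp only [SimpleGraph.Walk.mem_support_append_iff]
      tauto
    · intro z hz
      simp only [SimpleGraph.Walk.mem_support_append_iff]
      rcases Finset.mem_insert.1 hz with rfl | hz
      · right; left; right
        exact SimpleGraph.Walk.start_mem_support _
      · have hz' := hF z hz
        rw [← hspec, SimpleGraph.Walk.mem_support_append_iff] at hz'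
        tauto
    · have h := congrArg G.len hspec
      rw [len_append] at h
      rw [Finset.sum_insert hx]
      simp only [len_append, len_shortest, G.dist_comm (g x) x]
      linarith

end Metric

/-! ### Sums over the steps of a tour, and tours against closed walks. -/

section Tour

/-- The sum of `g` over the steps of the way from `u` through a list and then to `z`. -/
def stepSum {V : Type u} (g : V → V → ℝ) : V → List V → V → ℝ
  | u, [], z => g u z
  | u, x :: l, z => g u x + stepSum g x l z

theorem stepSum_mono {V : Type u} {g k : V → V → ℝ} (S : Set V)
    (h : ∀ a ∈ S, ∀ b ∈ S, g a b ≤ k a b) (l : List V) :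
    ∀ u z : V, u ∈ S → z ∈ S → (∀ x ∈ l, x ∈ S) → stepSum g u l z ≤ stepSum k u l z := by
  induction l with
  | nil => intro u z hu hz _; exact h u hu z hz
  | cons x l ih =>
    intro u z hu hz hl
    have hx := hl x (by simp)
    exact add_le_add (h u hu x hx) (ih x z hx hz fun y hy => hl y (by simp [hy]))

theorem stepSum_add {V : Type u} (g k : V → V → ℝ) (l : List V) : ∀ u z : V,
    stepSum (fun a b => g a b + k a b) u l z = stepSum g u l z + stepSum k u l z := by
  induction l with
  | nil => intro u z; rfl
  | cons x l ih => intro u z; simp only [stepSum, ih]; ring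

theorem stepSum_const {V : Type u} (c : ℝ) (l : List V) : ∀ u z : V,
    stepSum (fun _ _ => c) u l z = (l.length + 1) * c := by
  induction l with
  | nil => intro u z; simp [stepSum]
  | cons x l ih => intro u z; simp only [stepSum, ih, List.length_cons]; push_cast; ring

theorem stepSum_mul {V : Type u} (c : ℝ) (g : V → V → ℝ) (l : List V) : ∀ u z : V,
    stepSum (fun a b => c * g a b) u l z = c * stepSum g u l z := by
  induction l with
  | nil => intro u z; rfl
  | cons x l ih => intro u z; simp only [stepSum, ih]; ring

theorem stepSum_sum {V : Type u} {ι : Type*} (s : Finset ι) (g : ι → V → V → ℝ) (l : List V) :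
    ∀ u z : V, stepSum (fun a b => ∑ i ∈ s, g i a b) u l z = ∑ i ∈ s, stepSum (g i) u l z := by
  induction l with
  | nil => intro u z; rfl
  | cons x l ih => intro u z; simp only [stepSum, ih, Finset.sum_add_distrib]

/-- The indicator of a step between different fibres of `f`. -/
def change {V X : Type*} [DecidableEq X] (f : V → X) (a b : V) : ℝ := if f a = f b then 0 else 1

/-- If the fibres of `f` are consecutive in a list, then the closed tour of the list changes the
fibre at most as often as there are fibres. -/
theorem stepSum_change_le {V : Type u} {X : Type*} [DecidableEq V] [DecidableEq X] (f : V → X)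
    (l : List V) : ∀ u z : V,
      (∀ a b c : V, [a, b, c].Sublist (u :: l) → f a = f c → f b = f a) →
      stepSum (change f) u l z ≤ ((u :: l).toFinset.image f).card := by
  induction l with
  | nil =>
    intro u z _
    -- The closing step to `z` is charged to the fibre of the last node, so no condition on `z` is
    -- needed.
    simp only [stepSum, change]
    split_ifs <;> simp
  | cons x l ih =>
    intro u z h
    have ih' := ih x z fun a b c hs => h a b c (hs.trans (List.sublist_cons_self _ _))
    rw [stepSum, List.toFinset_cons (a := u), Finset.image_insert]
    by_cases hux : f u = f x
    · rw [Finset.insert_eq_of_mem]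
      · simpa [change, hux] using ih'
      · simp [hux]
    · rw [Finset.card_insert_of_notMem]
      · simp only [change, hux, if_false, Nat.cast_add, Nat.cast_one]
        linarith
      -- A later node in the fibre of `u` would force `x`, which lies between, into that fibre.
      · intro hmem
        simp only [Finset.mem_image, List.mem_toFinset, List.mem_cons] at hmem
        obtain ⟨c, rfl | hc, hfc⟩ := hmem
        · exact hux hfc.symm
        · refine hux (h u x c ?_ hfc.symm).symm
          exact ((List.singleton_sublist.2 hc).cons_cons x).cons_cons u

variable {V : Type u} (G : WeightedGraph V)

theorem throughLength_eq_stepSum (l : List V) : ∀ u z : V,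
    G.throughLength u l z = stepSum G.dist u l z := by
  induction l with
  | nil => intro u z; rfl
  | cons x l ih => intro u z; simp only [throughLength, stepSum, ih]

theorem throughLength_nonneg (l : List V) : ∀ u z : V, 0 ≤ G.throughLength u l z := by
  induction l with
  | nil => intro u z; exact G.dist_nonneg u z
  | cons x l ih => intro u z; exact add_nonneg (G.dist_nonneg u x) (ih x z)

theorem tourLength_nonneg (l : List V) : 0 ≤ G.tourLength l := by
  cases l with
  | nil => exact le_rfl
  | cons x l => exact G.throughLength_nonneg l x x

theorem throughLength_concat (x : V) (l : List V) : ∀ u z : V,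
    G.throughLength u (l ++ [x]) z = G.throughLength u l x + G.dist x z := by
  induction l with
  | nil => intro u z; rfl
  | cons y l ih => intro u z; simp only [List.cons_append, throughLength, ih]; ring

theorem tourLength_rotate (l : List V) (k : ℕ) : G.tourLength (l.rotate k) = G.tourLength l := by
  induction k generalizing l with
  | zero => simp
  | succ k ih =>
    cases l with
    | nil => simp
    | cons x l =>
      rw [List.rotate_cons_succ, ih]
      cases l with
      | nil => rfl
      | cons y l =>
        simp only [List.cons_append, tourLength, throughLength_concat, throughLength]
        ring

theorem throughLength_support_tail_le {u v : V} (p : G.graph.Walk u v) (z : V) :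
    G.throughLength u p.support.tail z ≤ G.len p + G.dist v z := by
  induction p with
  | nil => simp [throughLength, len]
  | @cons u u' v e p ih =>
    rw [len_cons, SimpleGraph.Walk.support_cons, List.tail_cons, ← SimpleGraph.Walk.cons_tail_support,
      throughLength]
    linarith [G.dist_le_w e]

variable [Fintype V]

theorem len_through (l : List V) : ∀ u z : V, G.len (G.through u l z) = G.throughLength u l z := by
  induction l with
  | nil => intro u z; exact G.len_shortest u z
  | cons x l ih => intro u z; simp only [through, throughLength, len_append, len_shortest, ih]

theorem throughLength_sublist {l k : List V} (h : l.Sublist k) : ∀ u z : V,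
    G.throughLength u l z ≤ G.throughLength u k z := by
  induction h with
  | slnil => intro u z; exact le_rfl
  | @cons l k x h ih =>
    intro u z
    refine le_trans ?_ (add_le_add le_rfl (ih x z))
    cases l with
    | nil => exact G.dist_triangle u x z
    | cons y l =>
      simp only [throughLength]
      linarith [G.dist_triangle u x y]
  | cons_cons x h ih => intro u z; exact add_le_add le_rfl (ih x z)

variable [DecidableEq V]

/-- Shortcutting: one occurrence of each node of `S` is kept from the support of `p`, and the
triangle inequality bounds the sublist. -/
theorem tspOpt_le_len {u : V} (p : G.graph.Walk u u) (S : Finset V) (hu : u ∈ S)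
    (hS : ∀ x ∈ S, x ∈ p.support) : G.tspOpt S ≤ G.len p := by
  set l := (p.support.tail.filter fun x => x ∈ S ∧ x ≠ u).dedup with hl
  have hmem : ∀ x, x ∈ l ↔ x ∈ p.support.tail ∧ x ∈ S ∧ x ≠ u := by simp [hl]
  have hnd : (u :: l).Nodup := by
    rw [List.nodup_cons]
    exact ⟨fun h => ((hmem u).1 h).2.2 rfl, List.nodup_dedup _⟩
  have hset : (u :: l).toFinset = S := by
    ext x
    simp only [List.mem_toFinset, List.mem_cons, hmem]
    constructor
    · rintro (rfl | h)
      · exact hu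
      · exact h.2.1
    · intro hx
      by_cases hxu : x = u
      · exact Or.inl hxu
      · have := hS x hx
        rw [← SimpleGraph.Walk.cons_tail_support, List.mem_cons] at this
        exact Or.inr ⟨this.resolve_left hxu, hx, hxu⟩
  have hbdd : BddBelow (Set.range fun l : {l : List V // l.Nodup ∧ l.toFinset = S} =>
      G.tourLength l.1) := ⟨0, by rintro _ ⟨q, rfl⟩; exact G.tourLength_nonneg _⟩
  refine (ciInf_le hbdd ⟨u :: l, hnd, hset⟩).trans ?_
  have hsub : l.Sublist p.support.tail := (List.dedup_sublist _).trans List.filter_sublist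
  have h1 := G.throughLength_sublist hsub u u
  have h2 := G.throughLength_support_tail_le p u
  rw [dist_self, add_zero] at h2
  exact h1.trans h2

end Tour

/-! ### Estimates for logarithms and for the number of levels. -/

section Logs

theorem le_log_of_two_le {x : ℝ} (hx : 2 ≤ x) : 1 ≤ Real.log x / Real.log 2 := by
  rw [one_le_div (Real.log_pos one_lt_two)]
  exact Real.log_le_log two_pos hx

theorem clog_two_le {n : ℕ} (hn : 2 ≤ n) :
    (Nat.clog 2 n : ℝ) ≤ 2 * (Real.log n / Real.log 2) := by
  have h1 : (Nat.clog 2 n : ℝ) ≤ Real.logb 2 n + 1 := by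
    have h := Real.ceil_logb_natCast (b := 2) (r := (n : ℝ)) (by positivity)
    rw [Int.clog_natCast] at h
    have h2 := (Int.ceil_lt_add_one (Real.logb (2 : ℕ) (n : ℝ))).le
    rw [h] at h2
    exact_mod_cast h2
  have h2 : (2 : ℝ) ≤ n := by exact_mod_cast hn
  have h3 := le_log_of_two_le h2
  rw [Real.logb] at h1
  linarith

variable {V : Type u} (G : WeightedGraph V)

theorem topLevel_add_one_le {σ : ℝ} (hσ : 1 ≤ σ) (hD : 1 ≤ G.diam) :
    (G.topLevel σ : ℝ) + 1 ≤ 3 * (Real.log (1 + G.diam) / Real.log 2) := by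
  have h0 : 0 ≤ Real.log G.diam := Real.log_nonneg hD
  have hl2 : 0 < Real.log 2 := Real.log_pos one_lt_two
  have h4 : Real.log 2 ≤ Real.log (4 * σ) := Real.log_le_log two_pos (by linarith)
  have hb : 0 ≤ Real.logb (4 * σ) G.diam := div_nonneg h0 (hl2.le.trans h4)
  have h1 : (G.topLevel σ : ℝ) ≤ Real.logb (4 * σ) G.diam + 1 := (Nat.ceil_lt_add_one hb).le
  have h2 : Real.logb (4 * σ) G.diam ≤ Real.log (1 + G.diam) / Real.log 2 :=
    div_le_div₀ (Real.log_nonneg (by linarith)) (Real.log_le_log (by linarith) (by linarith))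
      hl2 h4
  have h3 := le_log_of_two_le (x := 1 + G.diam) (by linarith)
  linarith

theorem diam_le_pow_topLevel {σ : ℝ} (hσ : 1 ≤ σ) : G.diam ≤ (4 * σ) ^ G.topLevel σ := by
  rcases G.diam_nonneg.eq_or_lt with h | h
  · rw [← h]; positivity
  · rw [← Real.rpow_natCast, ← Real.logb_le_iff_le_rpow (by linarith) h]
    exact Nat.le_ceil _

theorem radius_le_pow (σ : ℝ) (l : ℕ) : G.radius σ l ≤ (4 * σ) ^ l := min_le_right _ _

theorem radius_nonneg {σ : ℝ} (hσ : 1 ≤ σ) (l : ℕ) : 0 ≤ G.radius σ l :=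
  le_min G.diam_nonneg (by positivity)

end Logs

/-! ### Geometry of the cluster tree and the length of universal tours. -/

namespace PartitionHierarchy

variable {V : Type u} {G : WeightedGraph V} [Fintype V] [DecidableEq V] {σ : ℝ} {I : ℕ}
  (H : G.PartitionHierarchy σ I)

theorem cluster_mem (l : ℕ) (v : V) : H.cluster l v ∈ (H.part l).parts :=
  (H.part l).part_mem.2 (Finset.mem_univ v)

theorem mem_cluster (l : ℕ) (v : V) : v ∈ H.cluster l v :=
  (H.part l).mem_part (Finset.mem_univ v)

theorem cluster_eq_of_mem {l : ℕ} {u v : V} (h : u ∈ H.cluster l v) :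
    H.cluster l u = H.cluster l v :=
  (H.part l).part_eq_of_mem (H.cluster_mem l v) h

theorem leader_mem_cluster {l : ℕ} (hl : l ≤ G.topLevel σ) (v : V) :
    H.leader l (H.cluster l v) ∈ H.cluster l v :=
  H.leader_mem l hl _ (H.cluster_mem l v)

theorem dist_le_of_mem_cluster {l : ℕ} (hl : l ≤ G.topLevel σ) {u v z : V}
    (hu : u ∈ H.cluster l z) (hv : v ∈ H.cluster l z) : G.dist u v ≤ G.radius σ l * σ :=
  (H.sparse l hl).1 _ (H.cluster_mem l z) u hu v hv

theorem dist_leader_le {l : ℕ} (hl : l ≤ G.topLevel σ) (v : V) :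
    G.dist v (H.leader l (H.cluster l v)) ≤ G.radius σ l * σ :=
  H.dist_le_of_mem_cluster hl (H.mem_cluster l v) (H.leader_mem_cluster hl v)

theorem cluster_top (v : V) : H.cluster (G.topLevel σ) v = Finset.univ := by
  have h := H.cluster_mem (G.topLevel σ) v
  rwa [H.top, Finset.mem_singleton] at h

theorem card_image_cluster_le {l : ℕ} (hl : l ≤ G.topLevel σ) (c : V) (A : Finset V)
    (hA : ∀ v ∈ A, G.dist c v ≤ G.radius σ l) : (A.image (H.cluster l)).card ≤ I := by
  refine le_trans ?_ ((H.sparse l hl).2 c)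
  rw [← Set.ncard_coe_finset]
  refine Set.ncard_le_ncard ?_ (Set.toFinite _)
  intro X hX
  obtain ⟨v, hv, rfl⟩ := Finset.mem_image.1 (Finset.mem_coe.1 hX)
  exact ⟨H.cluster_mem l v, v, H.mem_cluster l v, hA v hv⟩

theorem one_le_intersection (H : G.PartitionHierarchy σ I) (hσ : 1 ≤ σ) (v : V) : 1 ≤ I := by
  have := H.card_image_cluster_le le_rfl v {v} (by simp [G.radius_nonneg hσ])
  simpa using this

/-- The node whose cluster of level `l` is the ancestor of `v` in that level. -/
def rep : ℕ → V → V
  | 0, v => v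
  | l + 1, v => H.leader l (H.ancestor l v)

theorem ancestor_eq (l : ℕ) (v : V) : H.ancestor l v = H.cluster l (H.rep l v) := by
  cases l <;> rfl

/-- A geometric sum: the hop to the leader at level `l` adds at most `σ ρ ^ l`, where `ρ = 4σ`, and
`1 / 3 + σ ≤ 4σ / 3` because `σ ≥ 1`. -/
theorem dist_rep_le (hσ : 1 ≤ σ) (v : V) :
    ∀ l ≤ G.topLevel σ, G.dist v (H.rep l v) ≤ (4 * σ) ^ l / 3 := by
  intro l
  induction l with
  | zero => intro _; simp [rep]
  | succ l ih =>
    intro hl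
    have hl' : l ≤ G.topLevel σ := (Nat.le_succ l).trans hl
    have h1 := ih hl'
    have h2 := H.dist_leader_le hl' (H.rep l v)
    have h3 := G.dist_triangle v (H.rep l v) (H.rep (l + 1) v)
    have h4 : H.rep (l + 1) v = H.leader l (H.cluster l (H.rep l v)) := by
      rw [← ancestor_eq]; rfl
    rw [← h4] at h2
    have h5 : G.radius σ l * σ ≤ (4 * σ) ^ l * σ :=
      mul_le_mul_of_nonneg_right (G.radius_le_pow σ l) (by linarith)
    have h6 : 0 ≤ (4 * σ) ^ l * (σ - 1) := mul_nonneg (by positivity) (by linarith)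
    rw [pow_succ]
    nlinarith

/-- The ancestor of `v` in level `l`, where all levels above the top one are equal to it. -/
def anc (l : ℕ) (v : V) : Finset V := H.ancestor (min l (G.topLevel σ)) v

theorem ancestor_eq_of_le {a b : V} {l m : ℕ} (hlm : l ≤ m)
    (h : H.ancestor l a = H.ancestor l b) : H.ancestor m a = H.ancestor m b := by
  induction hlm with
  | refl => exact h
  | step _ ih => simp only [ancestor, ih]

theorem anc_eq_of_le {a b : V} {l m : ℕ} (hlm : l ≤ m) (h : H.anc l a = H.anc l b) :
    H.anc m a = H.anc m b :=
  H.ancestor_eq_of_le (min_le_min_right _ hlm) h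

theorem anc_eq_of_top_le {l : ℕ} (hl : G.topLevel σ ≤ l) (a b : V) : H.anc l a = H.anc l b := by
  simp only [anc, min_eq_right hl, ancestor_eq, cluster_top]

theorem dist_le_of_anc_eq (hσ : 1 ≤ σ) {a b : V} {l : ℕ} (h : H.anc l a = H.anc l b) :
    G.dist a b ≤ (4 * σ) ^ (l + 1) := by
  have hj := min_le_right l (G.topLevel σ)
  rw [anc, anc] at h
  have hpow : (4 * σ) ^ (min l (G.topLevel σ)) ≤ (4 * σ) ^ l :=
    pow_le_pow_right₀ (by linarith) (min_le_left _ _)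
  set j := min l (G.topLevel σ)
  rw [ancestor_eq, ancestor_eq] at h
  have h1 := H.dist_rep_le hσ a j hj
  have h2 := H.dist_rep_le hσ b j hj
  have h3 := H.dist_le_of_mem_cluster hj (H.mem_cluster j (H.rep j a))
    (h ▸ H.mem_cluster j (H.rep j b))
  have h4 := G.dist_triangle a (H.rep j a) b
  have h5 := G.dist_triangle (H.rep j a) (H.rep j b) b
  rw [G.dist_comm (H.rep j b) b] at h5
  have h6 : G.radius σ j * σ ≤ (4 * σ) ^ j * σ :=
    mul_le_mul_of_nonneg_right (G.radius_le_pow σ j) (by linarith)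
  have h7 : 0 ≤ (4 * σ) ^ j * (σ - 1) := mul_nonneg (by positivity) (by linarith)
  have h8 : 0 < (4 * σ) ^ j := by positivity
  rw [pow_succ]
  have h9 : (4 * σ) ^ j * (4 * σ) ≤ (4 * σ) ^ l * (4 * σ) :=
    mul_le_mul_of_nonneg_right hpow (by linarith)
  nlinarith

/-- Cover `p` by balls of radius `ρ ^ l / 2`, with `ρ = 4σ`. Since `1 / 2 + 1 / 3 < 1`, the
representative of a node of `S` stays within `r_l` of the centre of its ball, and the `r_l`-ball of
a centre meets at most `I` clusters. Above the top level there is a single ancestor. -/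
theorem card_image_anc_le (hσ : 1 ≤ σ) {u v : V} (p : G.graph.Walk u v) (S : Finset V)
    (hS : ∀ x ∈ S, x ∈ p.support) (l : ℕ) :
    ((S.image (H.anc l)).card : ℝ) ≤ I * (1 + 2 * G.len p / (4 * σ) ^ l) := by
  have hI : (1 : ℝ) ≤ I := by exact_mod_cast H.one_le_intersection hσ u
  have hlen := G.len_nonneg p
  rcases le_total l (G.topLevel σ) with hl | hl
  · have hs : 0 < (4 * σ) ^ l / 2 := by positivity
    obtain ⟨C, hC, hcov⟩ := G.exists_cover hs p
    have hanc : ∀ x, H.anc l x = H.cluster l (H.rep l x) := fun x => by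
      rw [anc, min_eq_left hl, ancestor_eq]
    have hsub : S.image (H.anc l) ⊆ C.biUnion fun c =>
        ((Finset.univ.filter fun z => G.dist c z ≤ G.radius σ l).image (H.cluster l)) := by
      intro X hX
      obtain ⟨x, hx, rfl⟩ := Finset.mem_image.1 hX
      obtain ⟨c, hc, hcx⟩ := hcov x (hS x hx)
      refine Finset.mem_biUnion.2 ⟨c, hc, Finset.mem_image.2 ⟨H.rep l x, ?_, (hanc x).symm⟩⟩
      have h1 := H.dist_rep_le hσ x l hl
      have h2 := G.dist_triangle c x (H.rep l x)
      have h3 : 0 < (4 * σ) ^ l := by positivity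
      exact Finset.mem_filter.2 ⟨Finset.mem_univ _, le_min (G.dist_le_diam _ _) (by linarith)⟩
    have h1 : (S.image (H.anc l)).card ≤ C.card * I :=
      (Finset.card_le_card hsub).trans (Finset.card_biUnion_le_card_mul _ _ _ fun c _ =>
        H.card_image_cluster_le hl c _ fun v hv => (Finset.mem_filter.1 hv).2)
    have h2 : ((S.image (H.anc l)).card : ℝ) ≤ C.card * I := by exact_mod_cast h1
    refine h2.trans ?_
    rw [mul_comm]
    refine mul_le_mul_of_nonneg_left (hC.trans (le_of_eq ?_)) (by linarith)
    rw [div_div_eq_mul_div, mul_comm 2]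
  · have h1 : (S.image (H.anc l)).card ≤ 1 := by
      rw [Finset.card_le_one]
      intro X hX Y hY
      obtain ⟨x, -, rfl⟩ := Finset.mem_image.1 hX
      obtain ⟨y, -, rfl⟩ := Finset.mem_image.1 hY
      exact H.anc_eq_of_top_le hl x y
    have h2 : ((S.image (H.anc l)).card : ℝ) ≤ 1 := by exact_mod_cast h1
    have h3 : 0 ≤ 2 * G.len p / (4 * σ) ^ l := by positivity
    nlinarith

/-- Two nodes are close if they have a common ancestor in a low level; otherwise the level where
their ancestors become equal bounds their distance. -/
theorem dist_le_sum_change (hσ : 1 ≤ σ) {Λ : ℝ} (a b : V) (hΛ : G.dist a b ≤ Λ) (k m : ℕ)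
    (hkm : k ≤ m) : G.dist a b ≤ (4 * σ) ^ (k + 1) +
      ∑ l ∈ Finset.Ico k m, (4 * σ) ^ (l + 2) * change (H.anc l) a b +
      Λ * change (H.anc m) a b := by
  induction m, hkm using Nat.le_induction with
  | base =>
    unfold change
    split_ifs with h
    · simpa using H.dist_le_of_anc_eq hσ h
    · have : 0 < (4 * σ) ^ (k + 1) := by positivity
      simp; linarith
  | succ m hkm ih =>
    have hpos : 0 < (4 * σ) ^ (k + 1) := by positivity
    have hch : ∀ l, 0 ≤ change (H.anc l) a b := fun l => by unfold change; split_ifs <;> simp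
    have hsum : 0 ≤ ∑ l ∈ Finset.Ico k m, (4 * σ) ^ (l + 2) * change (H.anc l) a b :=
      Finset.sum_nonneg fun l _ => mul_nonneg (by positivity) (hch l)
    rw [Finset.sum_Ico_succ_top hkm]
    -- If the ancestors merge exactly at level `m + 1`, the new summand `l = m` pays `ρ ^ (m + 2)`,
    -- with `ρ = 4σ`; if they still differ there, the last term pays `Λ`.
    by_cases h : H.anc m a = H.anc m b
    · have h' := H.anc_eq_of_le (Nat.le_succ m) h
      simpa [change, h, h'] using ih
    · by_cases h' : H.anc (m + 1) a = H.anc (m + 1) b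
      · have := H.dist_le_of_anc_eq hσ h'
        simp only [change, h, h', if_false, if_true]
        unfold change at hsum
        linarith
      · have h2 : 0 < (4 * σ) ^ (m + 2) := by positivity
        simp only [change, h, h', if_false]
        unfold change at hsum
        linarith

variable {H} in
theorem IsUniversalTour.consecutive_filter {L : List V} (hL : H.IsUniversalTour L) (S : Finset V)
    (l : ℕ) (a b c : V) (h : [a, b, c].Sublist (L.filter (· ∈ S))) (hac : H.anc l a = H.anc l c) :
    H.anc l b = H.anc l a :=
  hL.consecutive _ (min_le_right _ _) a b c (h.trans List.filter_sublist) hac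

/-- The constant in the approximation bound of universal tours. -/
def tourConst (σ : ℝ) (I : ℕ) : ℝ :=
  (4 * (4 * σ) ^ 2 + 6 * I * (4 * σ) ^ 2 + 3 * I) / Real.log 2

theorem tourLength_filter_le_len (hσ : 1 ≤ σ) (hG : ∀ x y : V, x ≠ y → 1 ≤ G.dist x y)
    {L : List V} (hL : H.IsUniversalTour L) (S : Finset V) {u v : V} (p : G.graph.Walk u v)
    (hS : ∀ x ∈ S, x ∈ p.support) (hlen : 1 ≤ G.len p)
    (hdist : ∀ a ∈ S, ∀ b ∈ S, G.dist a b ≤ G.len p) (hn : 2 ≤ Fintype.card V) :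
    G.tourLength (L.filter (· ∈ S)) ≤
      tourConst σ I * Real.log (Fintype.card V) * G.len p := by
  set Λ := G.len p
  set n := Fintype.card V
  set ρ := 4 * σ with hρdef
  have hρ : 4 ≤ ρ := by linarith
  have hρ0 : 0 < ρ := by linarith
  have hlog2 : 0 < Real.log 2 := Real.log_pos one_lt_two
  have hn' : (2 : ℝ) ≤ n := by exact_mod_cast hn
  have hlogn : 0 ≤ Real.log n := Real.log_nonneg (by linarith)
  -- the levels
  have hex : ∃ m : ℕ, Λ ≤ ρ ^ m := pow_unbounded_of_one_lt Λ (by linarith) |>.imp fun _ h => h.le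
  set m := Nat.find hex with hm
  have hmΛ : Λ ≤ ρ ^ m := Nat.find_spec hex
  have hlow : ∀ l < m, ρ ^ l ≤ Λ := fun l hl => (not_le.1 (Nat.find_min hex hl)).le
  have hmρ : ρ ^ m ≤ ρ * Λ := by
    rcases Nat.eq_zero_or_pos m with h | h
    · rw [h, pow_zero]; nlinarith
    · obtain ⟨j, hj⟩ := Nat.exists_eq_succ_of_ne_zero h.ne'
      rw [hj, pow_succ, mul_comm]
      exact mul_le_mul_of_nonneg_left (hlow j (by omega)) hρ0.le
  set q := Nat.clog 2 n with hq
  -- Levels below `k` are not counted separately. The subtraction truncates: with fewer than `q`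
  -- levels below `m`, all of them are used and `k = 0`.
  set k := m - q with hk
  have hkm : k ≤ m := Nat.sub_le _ _
  have hcardn : (S.card : ℝ) ≤ n := by exact_mod_cast Finset.card_le_univ S
  -- A ball of radius `1 / 3` holds at most one node, as distinct nodes are at distance at least
  -- `1`; then `1 + 3Λ ≤ 4Λ`. This replaces the bound by `n` when `k = 0`.
  have hcardΛ : (S.card : ℝ) ≤ 4 * Λ := by
    obtain ⟨C, hC, hcov⟩ := G.exists_cover (s := 1 / 3) (by norm_num) p
    choose! c hcC hc using hcov
    have h1 : S.card ≤ C.card := by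
      refine Finset.card_le_card_of_injOn c (fun x hx => hcC x (hS x hx)) ?_
      intro x hx y hy hxy
      by_contra hne
      have h2 := hc x (hS x hx)
      have h3 := hc y (hS y hy)
      rw [G.dist_comm] at h2
      rw [← hxy] at h3
      linarith [hG x y hne, G.dist_triangle x (c x) y]
    have h2 : (S.card : ℝ) ≤ C.card := by exact_mod_cast h1
    have h3 : (C.card : ℝ) ≤ 1 + Λ / (1 / 3) := hC
    linarith
  -- The total over all steps of the base term `ρ ^ (k + 1)`. If `q ≤ m`, the factor `ρ ^ q ≥ n`
  -- absorbs the number of steps.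
  have hSk : S.card * ρ ^ (k + 1) ≤ 4 * ρ ^ 2 * Λ := by
    have : S.card * ρ ^ k ≤ 4 * ρ * Λ := by
      rcases le_total q m with hqm | hqm
      · have h1 : (n : ℝ) ≤ ρ ^ q := by
          calc (n : ℝ) ≤ (2 : ℝ) ^ q := by exact_mod_cast Nat.le_pow_clog one_lt_two n
            _ ≤ ρ ^ q := pow_le_pow_left₀ two_pos.le (by linarith) q
        calc S.card * ρ ^ k ≤ ρ ^ q * ρ ^ k :=
              mul_le_mul_of_nonneg_right (hcardn.trans h1) (by positivity)
          _ = ρ ^ m := by rw [← pow_add, hk, Nat.add_sub_cancel' hqm]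
          _ ≤ 4 * ρ * Λ := by nlinarith
      · rw [hk, Nat.sub_eq_zero_of_le hqm, pow_zero, mul_one]
        nlinarith
    rw [pow_succ]
    nlinarith
  have himg : ∀ l, ((S.image (H.anc l)).card : ℝ) ≤ I * (1 + 2 * Λ / ρ ^ l) :=
    fun l => H.card_image_anc_le hσ p S hS l
  have hlev : ∀ l ∈ Finset.Ico k m, ρ ^ (l + 2) * ((S.image (H.anc l)).card : ℝ) ≤
      3 * I * ρ ^ 2 * Λ := by
    intro l hl
    have h1 := hlow l (Finset.mem_Ico.1 hl).2
    have h2 : 0 < ρ ^ l := by positivity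
    calc ρ ^ (l + 2) * ((S.image (H.anc l)).card : ℝ)
        ≤ ρ ^ (l + 2) * (I * (1 + 2 * Λ / ρ ^ l)) :=
          mul_le_mul_of_nonneg_left (himg l) (by positivity)
      _ = I * ρ ^ 2 * (ρ ^ l + 2 * Λ) := by field_simp; ring
      _ ≤ I * ρ ^ 2 * (3 * Λ) := mul_le_mul_of_nonneg_left (by linarith) (by positivity)
      _ = _ := by ring
  have htop : ((S.image (H.anc m)).card : ℝ) ≤ 3 * I := by
    have h2 : 0 < ρ ^ m := by positivity
    have h3 : 2 * Λ / ρ ^ m ≤ 2 := by rw [div_le_iff₀ h2]; linarith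
    calc ((S.image (H.anc m)).card : ℝ) ≤ I * (1 + 2 * Λ / ρ ^ m) := himg m
      _ ≤ I * 3 := mul_le_mul_of_nonneg_left (by linarith) (by positivity)
      _ = _ := by ring
  have hmain : G.tourLength (L.filter (· ∈ S)) ≤
      4 * ρ ^ 2 * Λ + q * (3 * I * ρ ^ 2 * Λ) + Λ * (3 * I) := by
    have hset : (L.filter (· ∈ S)).toFinset = S := by
      ext x; simp [hL.mem x]
    have hnd : (L.filter (· ∈ S)).Nodup := hL.nodup.filter _
    have hcard := List.toFinset_card_of_nodup hnd
    have hcons := fun l => hL.consecutive_filter S l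
    rw [hset] at hcard
    rcases hlist : L.filter (· ∈ S) with _ | ⟨x, l⟩
    · simp only [tourLength]
      positivity
    · rw [hlist] at hset hcard hcons
      have hmem : ∀ y ∈ x :: l, y ∈ (S : Set V) := fun y hy => by
        rw [← hset]; simpa using hy
      rw [tourLength, throughLength_eq_stepSum]
      refine (stepSum_mono (S : Set V) (fun a ha b hb => H.dist_le_sum_change hσ a b
        (hdist a ha b hb) k m hkm) l x x (hmem x (by simp)) (hmem x (by simp))
        fun y hy => hmem y (by simp [hy])).trans ?_
      rw [stepSum_add, stepSum_add, stepSum_const, stepSum_sum, stepSum_mul]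
      have hch : ∀ j, stepSum (change (H.anc j)) x l x ≤ ((S.image (H.anc j)).card : ℝ) :=
        fun j => by
          have := stepSum_change_le (H.anc j) l x x (hcons j)
          rwa [hset] at this
      refine add_le_add (add_le_add ?_ ?_) ?_
      · have : ((l.length : ℝ) + 1) = S.card := by rw [hcard]; simp
        rw [this]; exact hSk
      · calc _ ≤ ∑ j ∈ Finset.Ico k m, 3 * I * ρ ^ 2 * Λ := by
              refine Finset.sum_le_sum fun j hj => ?_
              rw [stepSum_mul]
              exact (mul_le_mul_of_nonneg_left (hch j) (by positivity)).trans (hlev j hj)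
          _ = ((m - k : ℕ) : ℝ) * (3 * I * ρ ^ 2 * Λ) := by simp
          _ ≤ _ := by
              refine mul_le_mul_of_nonneg_right ?_ (by positivity)
              exact_mod_cast (by omega : m - k ≤ q)
      · exact mul_le_mul_of_nonneg_left ((hch m).trans htop) (by linarith)
  refine hmain.trans ?_
  have h1 := clog_two_le hn
  have h2 := le_log_of_two_le hn'
  set t := Real.log n / Real.log 2 with ht
  have hI : (0 : ℝ) ≤ I := Nat.cast_nonneg I
  calc 4 * ρ ^ 2 * Λ + q * (3 * I * ρ ^ 2 * Λ) + Λ * (3 * I)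
      ≤ t * (4 * ρ ^ 2 * Λ) + 2 * t * (3 * I * ρ ^ 2 * Λ) + t * (Λ * (3 * I)) := by
        refine add_le_add (add_le_add ?_ (mul_le_mul_of_nonneg_right h1 (by positivity))) ?_
        · exact le_mul_of_one_le_left (by positivity) h2
        · exact le_mul_of_one_le_left (by positivity) h2
    _ = tourConst σ I * Real.log n * Λ := by
        rw [tourConst, ht, ← hρdef]; field_simp; ring

end PartitionHierarchy

/-! ### Lower bounds for schedules and the cost of the algorithm. -/

section Costs

variable {V : Type u} {G : WeightedGraph V}

theorem sum_dist_le_of_subset {A T : Finset V} (h : A ⊆ T) (meet : V → V) :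
    ∑ t ∈ A, G.dist t (meet t) ≤ ∑ t ∈ T, G.dist t (meet t) :=
  Finset.sum_le_sum_of_subset_of_nonneg h fun _ _ _ => G.dist_nonneg _ _

variable [Fintype V]

theorem two_mul_dist_le_len {u x : V} (p : G.graph.Walk u u) (hx : x ∈ p.support) :
    2 * G.dist u x ≤ G.len p := by
  classical
  have h := congrArg G.len (p.take_spec hx)
  rw [len_append] at h
  linarith [G.dist_le_len (p.takeUntil x hx), G.dist_le_len (p.dropUntil x hx), G.dist_comm u x]

/-- If every ball of radius `r` holds at most `k` nodes of `A`, and `A` has at least `2 k` nodes,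
then the nodes of `A` cannot all meet a short walk at low cost. -/
theorem radius_mul_card_le {r k : ℝ} (hr : 0 < r) (hk : 0 ≤ k) {u v : V} (p : G.graph.Walk u v)
    (A : Finset V) (meet : V → V) (hmeet : ∀ t ∈ A, meet t ∈ p.support)
    (hball : ∀ c : V, ((A.filter fun t => G.dist c t ≤ r).card : ℝ) ≤ k)
    (hA : 2 * k ≤ A.card) :
    r * A.card ≤ 4 * ∑ t ∈ A, G.dist t (meet t) + 4 * k * G.len p := by
  classical
  obtain ⟨C, hC, hcov⟩ := G.exists_cover (half_pos hr) p
  -- Far nodes pay `r / 2` each by their own moves; near ones lie in the `r`-balls around the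
  -- centres covering `p`, at most `k` per ball.
  set far := A.filter fun t => ¬ G.dist t (meet t) ≤ r / 2
  set near := A.filter fun t => G.dist t (meet t) ≤ r / 2
  have hsplit : (near.card : ℝ) + far.card = A.card := by
    exact_mod_cast Finset.card_filter_add_card_filter_not (s := A)
      (fun t => G.dist t (meet t) ≤ r / 2)
  have hnear : (near.card : ℝ) ≤ C.card * k := by
    have hsub : near ⊆ C.biUnion fun c => A.filter fun t => G.dist c t ≤ r := by
      intro t ht
      obtain ⟨htA, ht⟩ := Finset.mem_filter.1 ht
      obtain ⟨c, hc, hct⟩ := hcov _ (hmeet t htA)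
      refine Finset.mem_biUnion.2 ⟨c, hc, Finset.mem_filter.2 ⟨htA, ?_⟩⟩
      linarith [G.dist_triangle c (meet t) t, G.dist_comm t (meet t)]
    have h1 : (near.card : ℝ) ≤ ∑ c ∈ C, ((A.filter fun t => G.dist c t ≤ r).card : ℝ) := by
      exact_mod_cast (Finset.card_le_card hsub).trans Finset.card_biUnion_le
    refine h1.trans ((Finset.sum_le_sum fun c _ => hball c).trans ?_)
    simp
  have hfar : far.card * (r / 2) ≤ ∑ t ∈ A, G.dist t (meet t) := by
    calc far.card * (r / 2) = ∑ t ∈ far, r / 2 := by simp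
      _ ≤ ∑ t ∈ far, G.dist t (meet t) :=
        Finset.sum_le_sum fun t ht => (not_le.1 (Finset.mem_filter.1 ht).2).le
      _ ≤ _ := Finset.sum_le_sum_of_subset_of_nonneg (Finset.filter_subset _ _)
        fun t _ _ => G.dist_nonneg _ _
  have hw := G.len_nonneg p
  have hsum : 0 ≤ ∑ t ∈ A, G.dist t (meet t) := Finset.sum_nonneg fun t _ => G.dist_nonneg _ _
  have hCr : C.card * r ≤ r + 2 * G.len p := by
    have := mul_le_mul_of_nonneg_right hC hr.le
    have h2 : (1 + G.len p / (r / 2)) * r = r + 2 * G.len p := by field_simp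
    linarith
  -- A walk shorter than `r / 2` needs one ball, so at most `k`, hence at most half of `A`, is near.
  -- For a longer walk the term `r` in `hCr` is absorbed by `2 * len p`.
  rcases lt_or_ge (G.len p) (r / 2) with h | h
  · have hC1 : C.card ≤ 1 := by
      have : (C.card : ℝ) < 2 := by
        by_contra hcon
        nlinarith [not_lt.1 hcon]
      have : C.card < 2 := by exact_mod_cast this
      omega
    have hC1' : (C.card : ℝ) ≤ 1 := by exact_mod_cast hC1
    have h1 : (near.card : ℝ) ≤ k := hnear.trans (by nlinarith)
    have h2 : (A.card : ℝ) ≤ 2 * far.card := by linarith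
    have h3 := mul_le_mul_of_nonneg_left h2 hr.le
    have h4 : 0 ≤ 4 * k * G.len p := by positivity
    linarith
  · have h1 := mul_le_mul_of_nonneg_right hnear hr.le
    have h2 : C.card * r * k ≤ 4 * G.len p * k :=
      mul_le_mul_of_nonneg_right (by linarith) hk
    rw [← hsplit]
    nlinarith

namespace PartitionHierarchy

variable [DecidableEq V] {σ : ℝ} {I : ℕ} (H : G.PartitionHierarchy σ I)

theorem tourConst_nonneg (σ : ℝ) (I : ℕ) : 0 ≤ tourConst σ I :=
  div_nonneg (by positivity) (Real.log_pos one_lt_two).le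

/-- The approximation guarantee of universal tours. -/
theorem tourLength_filter_le_tspOpt (hσ : 1 ≤ σ) (hG : ∀ x y : V, x ≠ y → 1 ≤ G.dist x y)
    {L : List V} (hL : H.IsUniversalTour L) (S : Finset V) :
    G.tourLength (L.filter (· ∈ S)) ≤
      tourConst σ I * Real.log (Fintype.card V) * G.tspOpt S := by
  have hconst : 0 ≤ tourConst σ I * Real.log (Fintype.card V) :=
    mul_nonneg (tourConst_nonneg σ I) (Real.log_natCast_nonneg _)
  have hset : (L.filter (· ∈ S)).toFinset = S := by
    ext x; simp [hL.mem x]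
  have hcard := List.toFinset_card_of_nodup (hL.nodup.filter (· ∈ S))
  rw [hset] at hcard
  rcases le_or_gt S.card 1 with h1 | h1
  · have h0 : G.tourLength (L.filter (· ∈ S)) = 0 := by
      rw [hcard] at h1
      rcases hlist : L.filter (· ∈ S) with _ | ⟨x, _ | ⟨y, l⟩⟩
      · rfl
      · exact G.dist_self x
      · rw [hlist] at h1
        simp at h1
    rw [h0]
    exact mul_nonneg hconst (Real.iInf_nonneg fun l => G.tourLength_nonneg l.1)
  have hn : 2 ≤ Fintype.card V := h1.trans_le (Finset.card_le_univ S)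
  have : Nonempty {l : List V // l.Nodup ∧ l.toFinset = S} := ⟨⟨_, hL.nodup.filter _, hset⟩⟩
  rw [tspOpt, Real.mul_iInf_of_nonneg hconst]
  refine le_ciInf ?_
  rintro ⟨l, -, hl⟩
  obtain ⟨x, l, rfl⟩ : ∃ x k, l = x :: k := by
    cases l with
    | nil => rw [← hl] at h1; simp at h1
    | cons x k => exact ⟨x, k, rfl⟩
  have hS : ∀ y ∈ S, y ∈ (G.through x l x).support := by
    intro y hy
    rw [← hl, List.mem_toFinset, List.mem_cons] at hy
    rcases hy with rfl | hy
    · exact SimpleGraph.Walk.start_mem_support _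
    · exact G.mem_support_through l x x y hy
  have hdist : ∀ a ∈ S, ∀ b ∈ S, G.dist a b ≤ G.len (G.through x l x) := fun a ha b hb => by
    linarith [two_mul_dist_le_len _ (hS a ha), two_mul_dist_le_len _ (hS b hb),
      G.dist_triangle a x b, G.dist_comm a x]
  obtain ⟨a, ha, b, hb, hab⟩ := Finset.one_lt_card.1 h1
  have hlen := (hG a b hab).trans (hdist a ha b hb)
  have := H.tourLength_filter_le_len hσ hG hL S (G.through x l x) hS hlen hdist hn
  rwa [len_through] at this

theorem unassigned_succ_subset (γ l : ℕ) (T : Finset V) :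
    H.unassigned γ T (l + 1) ⊆ H.unassigned γ T l := Finset.sdiff_subset

theorem unassigned_subset (γ : ℕ) (T : Finset V) : ∀ l, H.unassigned γ T l ⊆ T
  | 0 => subset_rfl
  | l + 1 => (H.unassigned_succ_subset γ l T).trans (unassigned_subset γ T l)

theorem assigned_subset_unassigned (γ l : ℕ) (T : Finset V) :
    H.assigned γ T l ⊆ H.unassigned γ T l := Finset.filter_subset _ _

theorem assigned_subset (γ l : ℕ) (T : Finset V) : H.assigned γ T l ⊆ T :=
  (H.assigned_subset_unassigned γ l T).trans (H.unassigned_subset γ T l)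

theorem card_unassigned_inter_cluster_le (γ l : ℕ) (T : Finset V) {t : V}
    (ht : t ∈ H.unassigned γ T (l + 1)) :
    (H.unassigned γ T (l + 1) ∩ H.cluster l t).card ≤ 2 * γ := by
  obtain ⟨ht1, ht2⟩ := Finset.mem_sdiff.1 ht
  refine (Finset.card_le_card (Finset.inter_subset_inter_right
    (H.unassigned_succ_subset γ l T))).trans ?_
  by_contra hcon
  exact ht2 (Finset.mem_filter.2 ⟨ht1, (not_le.1 hcon).le⟩)

theorem subset_unassigned_union (γ : ℕ) (T : Finset V) (m : ℕ) :
    T ⊆ H.unassigned γ T m ∪ (Finset.range m).biUnion (H.assigned γ T) := by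
  induction m with
  | zero => exact Finset.subset_union_left
  | succ m ih =>
    intro t ht
    rcases Finset.mem_union.1 (ih ht) with h | h
    · by_cases hs : t ∈ H.assigned γ T m
      · exact Finset.mem_union_right _ (Finset.mem_biUnion.2 ⟨m, by simp, hs⟩)
      · exact Finset.mem_union_left _ (Finset.mem_sdiff.2 ⟨h, hs⟩)
    · obtain ⟨j, hj, hjt⟩ := Finset.mem_biUnion.1 h
      refine Finset.mem_union_right _ (Finset.mem_biUnion.2 ⟨j, ?_, hjt⟩)
      have := Finset.mem_range.1 hj
      exact Finset.mem_range.2 (by omega)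

theorem card_unassigned_top_le (γ : ℕ) (T : Finset V) :
    (H.unassigned γ T (G.topLevel σ + 1)).card ≤ 2 * γ := by
  rcases (H.unassigned γ T (G.topLevel σ + 1)).eq_empty_or_nonempty with h | ⟨t, ht⟩
  · simp [h]
  · have := H.card_unassigned_inter_cluster_le γ _ T ht
    rwa [cluster_top, Finset.inter_univ] at this

/-- Few transactions of a ball are left over for the next level. -/
theorem card_unassigned_ball_le (γ l : ℕ) (hl : l ≤ G.topLevel σ) (T : Finset V) (c : V)
    (A : Finset V) (hA : A ⊆ H.unassigned γ T (l + 1)) :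
    (A.filter fun t => G.dist c t ≤ G.radius σ l).card ≤ 2 * γ * I := by
  set B := A.filter fun t => G.dist c t ≤ G.radius σ l
  have h1 := H.card_image_cluster_le hl c B fun v hv => (Finset.mem_filter.1 hv).2
  refine (Finset.card_le_mul_card_image (f := H.cluster l) B (2 * γ) ?_).trans
    (Nat.mul_le_mul_left _ h1)
  intro X hX
  obtain ⟨t, ht, rfl⟩ := Finset.mem_image.1 hX
  have htU := hA (Finset.mem_filter.1 ht).1
  refine (Finset.card_le_card ?_).trans (H.card_unassigned_inter_cluster_le γ l T htU)
  intro y hy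
  obtain ⟨hyB, hyX⟩ := Finset.mem_filter.1 hy
  exact Finset.mem_inter.2 ⟨hA (Finset.mem_filter.1 hyB).1, hyX ▸ H.mem_cluster l y⟩

/-- The radius of the previous level works, at the loss of a factor `4σ`. Level `0` has no
predecessor; there `1 / 4` works, because such a ball holds at most one node. -/
theorem exists_sparse_radius (hσ : 1 ≤ σ) (hG : ∀ x y : V, x ≠ y → 1 ≤ G.dist x y)
    (hD : 1 ≤ G.diam) {γ : ℕ} (hγ : 1 ≤ γ) (hI : 1 ≤ I) (T : Finset V) (l : ℕ)
    (hl : l ≤ G.topLevel σ) : ∃ r : ℝ, 0 < r ∧ G.radius σ l ≤ 4 * σ * r ∧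
      ∀ c : V, ((H.assigned γ T l).filter fun t => G.dist c t ≤ r).card ≤ 2 * γ * I := by
  cases l with
  | zero =>
    refine ⟨1 / 4, by norm_num, ?_, fun c => ?_⟩
    · have := G.radius_le_pow σ 0
      rw [pow_zero] at this
      linarith
    · refine le_trans (Finset.card_le_one.2 ?_) (Nat.mul_pos (by omega) hI)
      intro x hx y hy
      by_contra hne
      have h1 := (Finset.mem_filter.1 hx).2
      have h2 := (Finset.mem_filter.1 hy).2
      linarith [hG x y hne, G.dist_triangle x c y, G.dist_comm x c]
  | succ l =>
    have hpos : 0 < (4 * σ) ^ l := by positivity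
    have hr : 0 < G.radius σ l := lt_min (by linarith) hpos
    refine ⟨G.radius σ l, hr, ?_, fun c =>
      H.card_unassigned_ball_le γ l (by omega) T c _ (H.assigned_subset_unassigned γ _ T)⟩
    rcases le_total G.diam ((4 * σ) ^ l) with h | h
    · rw [radius, radius, min_eq_left h]
      refine (min_le_left _ _).trans ?_
      nlinarith
    · rw [radius, radius, min_eq_right h]
      refine (min_le_right _ _).trans (le_of_eq ?_)
      rw [pow_succ, mul_comm]

theorem mem_keptLevels {a : ℝ} {T : Finset V} {l : ℕ} : l ∈ H.keptLevels a T ↔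
    l ≤ G.topLevel σ ∧ 8 * (I : ℝ) * a ≤ ((H.assigned ⌈a⌉₊ T l).card : ℝ) := by
  rw [keptLevels, Finset.mem_filter, Finset.mem_range, Nat.lt_succ_iff]

theorem ceil_le_two_mul {a : ℝ} (ha : 1 < a) : (⌈a⌉₊ : ℝ) ≤ 2 * a := by
  linarith [Nat.ceil_lt_add_one (a := a) (by linarith)]

/-- Moving the transactions of one level to their dedicated super-leaders costs at most a constant
factor more than any schedule. -/
theorem radius_mul_card_assigned_le (hσ : 1 ≤ σ) (hG : ∀ x y : V, x ≠ y → 1 ≤ G.dist x y)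
    (hD : 1 ≤ G.diam) {α β : ℝ} (hβ : 0 < β) (hαβ : β < α) (T : Finset V) {u v : V}
    (p : G.graph.Walk u v) (meet : V → V) (hmeet : ∀ t ∈ T, meet t ∈ p.support)
    {l : ℕ} (hl : l ∈ H.keptLevels (α / β) T) :
    β * (G.radius σ l * (H.assigned ⌈α / β⌉₊ T l).card) ≤
      64 * σ * I * (α * G.len p + β * ∑ t ∈ T, G.dist t (meet t)) := by
  have hI := H.one_le_intersection hσ u
  have hI' : (1 : ℝ) ≤ I := by exact_mod_cast hI
  obtain ⟨hltop, hcard⟩ := H.mem_keptLevels.1 hl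
  have ha : 1 < α / β := by rwa [one_lt_div hβ]
  have hβa : β * (α / β) = α := mul_div_cancel₀ _ hβ.ne'
  set a := α / β
  have hγ2 := ceil_le_two_mul ha
  have hγ1 : 1 ≤ ⌈a⌉₊ := Nat.one_le_ceil_iff.2 (by linarith)
  set γ := ⌈a⌉₊
  set A := H.assigned γ T l
  obtain ⟨r, hr, hlr, hball⟩ := H.exists_sparse_radius hσ hG hD hγ1 hI T l hltop
  -- With `k = 4 a I`, the condition `2 k ≤ |A|` of `radius_mul_card_le` is exactly the pruning
  -- threshold `8 I a`.
  have hk : (2 * γ * I : ℝ) ≤ 4 * a * I :=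
    mul_le_mul_of_nonneg_right (by linarith) (by linarith)
  have hA := H.assigned_subset γ l T
  have h1 := radius_mul_card_le hr (by positivity : (0 : ℝ) ≤ 4 * a * I) p A meet
    (fun t ht => hmeet t (hA ht)) (fun c => le_trans (by exact_mod_cast hball c) hk) (by linarith)
  have h2 := sum_dist_le_of_subset (G := G) hA meet
  set M := ∑ t ∈ T, G.dist t (meet t)
  have hM : 0 ≤ M := Finset.sum_nonneg fun t _ => G.dist_nonneg _ _
  have h3 : r * A.card ≤ 4 * M + 16 * a * I * G.len p := by linarith
  calc β * (G.radius σ l * A.card) ≤ β * (4 * σ * r * A.card) := by gcongr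
    _ = 4 * σ * (β * (r * A.card)) := by ring
    _ ≤ 4 * σ * (β * (4 * M + 16 * a * I * G.len p)) := by gcongr
    _ = 64 * σ * I * ((β * a) * G.len p) + 16 * σ * 1 * (β * M) := by ring
    _ ≤ 64 * σ * I * ((β * a) * G.len p) + 64 * σ * I * (β * M) := by
      gcongr
      norm_num
    _ = _ := by rw [hβa]; ring

theorem card_keptLevels_le (a : ℝ) (T : Finset V) :
    ((H.keptLevels a T).card : ℝ) ≤ G.topLevel σ + 1 := by
  have h : (H.keptLevels a T).card ≤ G.topLevel σ + 1 :=
    (Finset.card_filter_le _ _).trans (Finset.card_range _).le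
  exact_mod_cast h

/-- The transactions of a level whose dedicated super-leader is `x`. -/
def fibre (γ : ℕ) (T : Finset V) (l : ℕ) (x : V) : Finset V :=
  {t ∈ H.assigned γ T l | H.leader l (H.cluster l t) = x}

theorem le_card_fibre {γ l : ℕ} {T : Finset V} {x : V} (hx : x ∈ H.superLeaders γ T l) :
    2 * γ ≤ (H.fibre γ T l x).card := by
  obtain ⟨t, ht, rfl⟩ := Finset.mem_image.1 hx
  have hcard := (Finset.mem_filter.1 ht).2
  refine hcard.trans (Finset.card_le_card ?_)
  intro y hy
  obtain ⟨hyU, hyX⟩ := Finset.mem_inter.1 hy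
  have heq := H.cluster_eq_of_mem hyX
  refine Finset.mem_filter.2 ⟨Finset.mem_filter.2 ⟨hyU, ?_⟩, by rw [heq]⟩
  rwa [heq]

/-- A super-leader is reached from a walk by a detour that is paid for by its transactions. -/
theorem exists_detour {α β : ℝ} (hβ : 0 < β) (hαβ : β < α) (T : Finset V) (meet : V → V)
    {l : ℕ} (hl : l ≤ G.topLevel σ) {x : V} (hx : x ∈ H.superLeaders ⌈α / β⌉₊ T l) :
    ∃ t ∈ T, α * (2 * G.dist x (meet t)) ≤
      β * ∑ t ∈ H.fibre ⌈α / β⌉₊ T l x, (G.radius σ l * σ + G.dist t (meet t)) := by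
  have ha : 1 < α / β := by rwa [one_lt_div hβ]
  have hγ : α ≤ β * (⌈α / β⌉₊ : ℝ) := by
    have := mul_le_mul_of_nonneg_left (Nat.le_ceil (α / β)) hβ.le
    rwa [mul_div_cancel₀ _ hβ.ne'] at this
  have hγ1 : 1 ≤ ⌈α / β⌉₊ := Nat.one_le_ceil_iff.2 (by linarith)
  have hF := H.le_card_fibre hx
  set γ := ⌈α / β⌉₊
  set F := H.fibre γ T l x with hFdef
  have hne : F.Nonempty := Finset.card_pos.1 (by omega)
  -- For the cheapest transaction of the fibre, the detour bound is at most the term of every other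
  -- one. The `2γ` terms pay for the way out and back, since `βγ ≥ α`.
  obtain ⟨t, ht, hmin⟩ := Finset.exists_min_image F (fun t => G.dist t (meet t)) hne
  obtain ⟨htA, htx⟩ := Finset.mem_filter.1 ht
  refine ⟨t, H.assigned_subset γ l T htA, ?_⟩
  have hxt : G.dist x t ≤ G.radius σ l * σ := by
    rw [← htx, G.dist_comm]
    exact H.dist_leader_le hl t
  have h1 : G.dist x (meet t) ≤ G.radius σ l * σ + G.dist t (meet t) :=
    (G.dist_triangle x t (meet t)).trans (add_le_add hxt le_rfl)
  have h0 := G.dist_nonneg x (meet t)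
  set b := G.radius σ l * σ + G.dist t (meet t)
  have hF' : (2 * γ : ℝ) ≤ F.card := by exact_mod_cast hF
  calc α * (2 * G.dist x (meet t)) ≤ (β * γ) * (2 * b) := by gcongr
    _ = β * (2 * γ * b) := by ring
    _ ≤ β * (F.card * b) := by
      have : 0 ≤ b := h0.trans h1
      gcongr
    _ = β * ∑ s ∈ F, b := by simp
    _ ≤ _ := by
      refine mul_le_mul_of_nonneg_left (Finset.sum_le_sum fun s hs => ?_) hβ.le
      exact add_le_add le_rfl (hmin s hs)

/-- An optimal tour of the super-leaders that survive the pruning. -/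
theorem tspOpt_finalLeaders_le (hσ : 1 ≤ σ) (hG : ∀ x y : V, x ≠ y → 1 ≤ G.dist x y)
    (hD : 1 ≤ G.diam) {α β : ℝ} (hβ : 0 < β) (hαβ : β < α) (T : Finset V) {u v : V}
    (p : G.graph.Walk u v) (meet : V → V) (hmeet : ∀ t ∈ T, meet t ∈ p.support) :
    α * G.tspOpt (insert u (H.finalLeaders (α / β) T)) ≤
      (2 + (G.topLevel σ + 1) * (64 * σ ^ 2 * I + 1)) *
        (α * G.len p + β * ∑ t ∈ T, G.dist t (meet t)) := by
  set B := α * G.len p + β * ∑ t ∈ T, G.dist t (meet t) with hB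
  set R := H.keptLevels (α / β) T with hR
  set F := H.finalLeaders (α / β) T with hF
  have hM : 0 ≤ ∑ t ∈ T, G.dist t (meet t) := Finset.sum_nonneg fun t _ => G.dist_nonneg _ _
  have hw := G.len_nonneg p
  have hα : 0 < α := hβ.trans hαβ
  have hB0 : 0 ≤ B := by positivity
  have hex : ∀ x ∈ F, ∃ y ∈ p.support, α * (2 * G.dist x y) ≤ ∑ l ∈ R,
      β * ∑ t ∈ H.fibre ⌈α / β⌉₊ T l x, (G.radius σ l * σ + G.dist t (meet t)) := by
    intro x hx
    obtain ⟨l, hl, hxl⟩ := Finset.mem_biUnion.1 hx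
    obtain ⟨t, ht, h⟩ := H.exists_detour hβ hαβ T meet (H.mem_keptLevels.1 hl).1 hxl
    -- A node may be a super-leader on several levels; summing over all of them avoids choosing one.
    refine ⟨meet t, hmeet t ht, h.trans ?_⟩
    refine Finset.single_le_sum (f := fun l =>
      β * ∑ t ∈ H.fibre ⌈α / β⌉₊ T l x, (G.radius σ l * σ + G.dist t (meet t))) ?_ hl
    intro j _
    exact mul_nonneg hβ.le (Finset.sum_nonneg fun t _ => add_nonneg
      (mul_nonneg (G.radius_nonneg hσ j) (by linarith)) (G.dist_nonneg _ _))
  choose! g hg hgd using hex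
  -- Going back along `p` closes the object's walk; this gives the `2` in the bound.
  obtain ⟨q, hpq, hFq, hq⟩ := G.exists_detour_walk (p.append p.reverse) g F fun x hx => by
    rw [SimpleGraph.Walk.mem_support_append_iff]
    exact Or.inl (hg x hx)
  have hopt : G.tspOpt (insert u F) ≤ G.len q := by
    refine G.tspOpt_le_len q _ (Finset.mem_insert_self _ _) fun x hx => ?_
    rcases Finset.mem_insert.1 hx with rfl | hx
    · exact SimpleGraph.Walk.start_mem_support _
    · exact hFq x hx
  rw [len_append, len_reverse] at hq
  have hdet : ∑ x ∈ F, α * (2 * G.dist x (g x)) ≤ R.card * ((64 * σ ^ 2 * I + 1) * B) := by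
    calc ∑ x ∈ F, α * (2 * G.dist x (g x))
        ≤ ∑ x ∈ F, ∑ l ∈ R, β * ∑ t ∈ H.fibre ⌈α / β⌉₊ T l x,
          (G.radius σ l * σ + G.dist t (meet t)) := Finset.sum_le_sum fun x hx => hgd x hx
      _ = ∑ l ∈ R, β * ∑ t ∈ H.assigned ⌈α / β⌉₊ T l,
          (G.radius σ l * σ + G.dist t (meet t)) := by
        rw [Finset.sum_comm]
        refine Finset.sum_congr rfl fun l hl => ?_
        rw [← Finset.mul_sum]
        congr 1
        refine Finset.sum_fiberwise_of_maps_to (fun t ht => ?_) _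
        exact Finset.mem_biUnion.2 ⟨l, hl, Finset.mem_image_of_mem _ ht⟩
      _ ≤ ∑ l ∈ R, (64 * σ ^ 2 * I + 1) * B := by
        refine Finset.sum_le_sum fun l hl => ?_
        have h1 := H.radius_mul_card_assigned_le hσ hG hD hβ hαβ T p meet hmeet hl
        have h2 := sum_dist_le_of_subset (G := G) (H.assigned_subset ⌈α / β⌉₊ l T) meet
        have h3 := mul_le_mul_of_nonneg_left h2 hβ.le
        have h4 := mul_le_mul_of_nonneg_right h1 (by linarith : 0 ≤ σ)
        rw [← hB] at h4
        have h5 : β * ∑ t ∈ T, G.dist t (meet t) ≤ B := by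
          rw [hB]; linarith [mul_nonneg hα.le hw]
        rw [Finset.sum_add_distrib, Finset.sum_const, nsmul_eq_mul, mul_add]
        calc _ = β * (G.radius σ l * (H.assigned ⌈α / β⌉₊ T l).card) * σ +
              β * ∑ t ∈ H.assigned ⌈α / β⌉₊ T l, G.dist t (meet t) := by ring
          _ ≤ 64 * σ * I * B * σ + B := add_le_add h4 (h3.trans h5)
          _ = _ := by ring
      _ = _ := by simp
  rw [← Finset.mul_sum] at hdet
  have hcard := H.card_keptLevels_le (α / β) T
  rw [← hR] at hcard
  have h6 : R.card * ((64 * σ ^ 2 * I + 1) * B) ≤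
      (G.topLevel σ + 1) * ((64 * σ ^ 2 * I + 1) * B) :=
    mul_le_mul_of_nonneg_right hcard (by positivity)
  have h7 : 2 * (α * G.len p) ≤ 2 * B := by
    rw [hB]; linarith [mul_nonneg hβ.le hM]
  have h8 := mul_le_mul_of_nonneg_left (hopt.trans hq) hα.le
  rw [mul_add] at h8
  linarith

/-- The transactions without a dedicated super-leader after the pruning are few. -/
theorem card_pruned_le {a : ℝ} (ha : 1 < a) (T : Finset V) :
    ((T \ (H.keptLevels a T).biUnion (H.assigned ⌈a⌉₊ T)).card : ℝ) ≤
      4 * a + (G.topLevel σ + 1) * (8 * I * a) := by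
  set R := H.keptLevels a T with hR
  set N := Finset.range (G.topLevel σ + 1) with hN
  have hsub : T \ R.biUnion (H.assigned ⌈a⌉₊ T) ⊆
      H.unassigned ⌈a⌉₊ T (G.topLevel σ + 1) ∪ (N \ R).biUnion (H.assigned ⌈a⌉₊ T) := by
    intro t ht
    obtain ⟨htT, htR⟩ := Finset.mem_sdiff.1 ht
    rcases Finset.mem_union.1 (H.subset_unassigned_union ⌈a⌉₊ T _ htT) with h | h
    · exact Finset.mem_union_left _ h
    · obtain ⟨l, hl, hlt⟩ := Finset.mem_biUnion.1 h
      refine Finset.mem_union_right _ (Finset.mem_biUnion.2 ⟨l, Finset.mem_sdiff.2 ⟨hl, ?_⟩, hlt⟩)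
      exact fun hlR => htR (Finset.mem_biUnion.2 ⟨l, hlR, hlt⟩)
  have h1 := ((Finset.card_le_card hsub).trans (Finset.card_union_le _ _)).trans
    (add_le_add (H.card_unassigned_top_le ⌈a⌉₊ T) Finset.card_biUnion_le)
  have h2 : ((T \ R.biUnion (H.assigned ⌈a⌉₊ T)).card : ℝ) ≤
      2 * ⌈a⌉₊ + ∑ l ∈ N \ R, ((H.assigned ⌈a⌉₊ T l).card : ℝ) := by exact_mod_cast h1
  have h3 : ∑ l ∈ N \ R, ((H.assigned ⌈a⌉₊ T l).card : ℝ) ≤ ∑ l ∈ N \ R, 8 * I * a := by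
    refine Finset.sum_le_sum fun l hl => ?_
    obtain ⟨hlN, hlR⟩ := Finset.mem_sdiff.1 hl
    by_contra hcon
    exact hlR (Finset.mem_filter.2 ⟨hlN, (not_le.1 hcon).le⟩)
  have h4 : ((N \ R).card : ℝ) ≤ G.topLevel σ + 1 := by
    have := Finset.card_le_card (Finset.sdiff_subset : N \ R ⊆ N)
    rw [hN, Finset.card_range] at this
    exact_mod_cast this
  rw [Finset.sum_const, nsmul_eq_mul] at h3
  have h5 := mul_le_mul_of_nonneg_right h4 (by positivity : (0 : ℝ) ≤ 8 * I * a)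
  linarith [ceil_le_two_mul ha]

/-- The cost of moving the transactions. -/
theorem sum_dist_destination_le (hσ : 1 ≤ σ) (hG : ∀ x y : V, x ≠ y → 1 ≤ G.dist x y)
    (hD : 1 ≤ G.diam) {α β : ℝ} (hβ : 0 < β) (hαβ : β < α) (T : Finset V) {u v : V}
    (p : G.graph.Walk u v) (meet : V → V) (hmeet : ∀ t ∈ T, meet t ∈ p.support) :
    β * ∑ t ∈ T, G.dist t (H.destination (α / β) u T t) ≤
      (5 + (G.topLevel σ + 1) * (64 * σ ^ 2 * I + 8 * I)) *
        (α * G.len p + β * ∑ t ∈ T, G.dist t (meet t)) := by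
  set B := α * G.len p + β * ∑ t ∈ T, G.dist t (meet t) with hB
  set R := H.keptLevels (α / β) T with hR
  set γ := ⌈α / β⌉₊ with hγ
  set P := T \ R.biUnion (H.assigned γ T) with hP
  have hM : 0 ≤ ∑ t ∈ T, G.dist t (meet t) := Finset.sum_nonneg fun t _ => G.dist_nonneg _ _
  have hw := G.len_nonneg p
  have hα : 0 < α := hβ.trans hαβ
  have hB0 : 0 ≤ B := by positivity
  have ha : 1 < α / β := by rwa [one_lt_div hβ]
  have hβa : β * (α / β) = α := mul_div_cancel₀ _ hβ.ne'
  -- Either the cluster diameter on a surviving level, or, for a pruned transaction, its own move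
  -- followed by the way back along `p` to the start.
  have hpt : ∀ t ∈ T, G.dist t (H.destination (α / β) u T t) ≤
      (∑ l ∈ R, if t ∈ H.assigned γ T l then G.radius σ l * σ else 0) +
        (if t ∈ P then G.len p else 0) + G.dist t (meet t) := by
    intro t ht
    have hnn : ∀ l ∈ R, 0 ≤ if t ∈ H.assigned γ T l then G.radius σ l * σ else 0 := by
      intro l _
      split_ifs
      · exact mul_nonneg (G.radius_nonneg hσ l) (by linarith)
      · exact le_rfl
    have hd := G.dist_nonneg t (meet t)
    unfold destination
    split_ifs with h hc hc
    · exact absurd (Finset.mem_biUnion.2 h) (Finset.mem_sdiff.1 hc).2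
    · obtain ⟨hl, htl⟩ := Nat.find_spec h
      set l := Nat.find h
      have h1 := H.dist_leader_le (H.mem_keptLevels.1 hl).1 t
      have h2 := Finset.single_le_sum hnn hl
      rw [if_pos htl] at h2
      linarith
    · have h1 := G.dist_le_len_of_mem_support p (hmeet t ht)
      linarith [Finset.sum_nonneg hnn, G.dist_triangle t (meet t) u, G.dist_comm (meet t) u]
    · refine absurd (Finset.mem_sdiff.2 ⟨ht, fun hmem => h ?_⟩) hc
      exact Finset.mem_biUnion.1 hmem
  have hsum := Finset.sum_le_sum hpt
  rw [Finset.sum_add_distrib, Finset.sum_add_distrib, Finset.sum_comm] at hsum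
  have h1 : β * ∑ l ∈ R, ∑ t ∈ T, (if t ∈ H.assigned γ T l then G.radius σ l * σ else 0) ≤
      (G.topLevel σ + 1) * (64 * σ ^ 2 * I * B) := by
    have hcard := H.card_keptLevels_le (α / β) T
    rw [← hR] at hcard
    rw [Finset.mul_sum]
    refine le_trans (Finset.sum_le_sum (g := fun _ => 64 * σ ^ 2 * I * B) fun l hl => ?_) ?_
    · have h1 := H.radius_mul_card_assigned_le hσ hG hD hβ hαβ T p meet hmeet hl
      have h4 := mul_le_mul_of_nonneg_right h1 (by linarith : 0 ≤ σ)
      rw [Finset.sum_ite_mem, Finset.inter_eq_right.2 (H.assigned_subset γ l T), Finset.sum_const,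
        nsmul_eq_mul]
      calc _ = β * (G.radius σ l * (H.assigned γ T l).card) * σ := by ring
        _ ≤ _ := h4
        _ = _ := by ring
    · rw [Finset.sum_const, nsmul_eq_mul]
      exact mul_le_mul_of_nonneg_right hcard (by positivity)
  have h2 : β * ∑ t ∈ T, (if t ∈ P then G.len p else 0) ≤
      (4 + (G.topLevel σ + 1) * (8 * I)) * (α * G.len p) := by
    rw [Finset.sum_ite_mem, Finset.inter_eq_right.2 Finset.sdiff_subset, Finset.sum_const,
      nsmul_eq_mul]
    have := mul_le_mul_of_nonneg_right (H.card_pruned_le ha T) hw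
    have h3 := mul_le_mul_of_nonneg_left this hβ.le
    refine h3.trans (le_of_eq ?_)
    calc _ = (4 + (G.topLevel σ + 1) * (8 * I)) * ((β * (α / β)) * G.len p) := by ring
      _ = _ := by rw [hβa]
  have h5 := mul_le_mul_of_nonneg_left hsum hβ.le
  rw [mul_add, mul_add] at h5
  have h6 : α * G.len p ≤ B := by rw [hB]; linarith [mul_nonneg hβ.le hM]
  have h7 : β * ∑ t ∈ T, G.dist t (meet t) ≤ B := by
    rw [hB]; linarith [mul_nonneg hα.le hw]
  have h8 : (4 + (G.topLevel σ + 1) * (8 * I)) * (α * G.len p) ≤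
      (4 + (G.topLevel σ + 1) * (8 * I)) * B := mul_le_mul_of_nonneg_left h6 (by positivity)
  linarith

theorem throughLength_stops {L : List V} (hL : ∀ v, v ∈ L) (a : ℝ) (home : V) (T : Finset V) :
    G.throughLength home (H.stops L a home T) home =
      G.tourLength (L.filter (· ∈ insert home (H.finalLeaders a T))) := by
  set l := L.filter (· ∈ insert home (H.finalLeaders a T))
  change G.throughLength home ((l.rotate (l.idxOf home)).erase home) home = _
  have hmem : home ∈ l := by simp [l, hL home]
  have hlt := List.idxOf_lt_length_of_mem hmem
  have hrot := List.rotate_eq_drop_append_take hlt.le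
  rw [List.drop_eq_getElem_cons hlt, List.getElem_idxOf, List.cons_append] at hrot
  rw [← G.tourLength_rotate l (l.idxOf home), hrot, List.erase_cons_head]
  rfl

/-- The constant in the approximation bound of the algorithm. -/
def algConst (σ : ℝ) (I : ℕ) : ℝ :=
  (tourConst σ I + 1 / Real.log 2) * (3 * (64 * σ ^ 2 * I + 8 * I + 6) / Real.log 2)

/-- Only the object's tour needs the factor `log n`; for the transactions it is inserted through `1
≤ log n / log 2`. With a single node both logarithms vanish, so the cost is shown to be zero
separately. -/
theorem cost_globalAware_le (hσ : 1 ≤ σ) (hG : ∀ x y : V, x ≠ y → 1 ≤ G.dist x y)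
    {L : List V} (hL : H.IsUniversalTour L) {α β : ℝ} (hβ : 0 < β) (hαβ : β < α) (home : V)
    (T : Finset V) (E : G.Schedule home T) :
    (H.globalAware L hL (α / β) home T).cost α β ≤
      algConst σ I * (Real.log (Fintype.card V) * Real.log (1 + G.diam)) * E.cost α β := by
  have hα : 0 < α := hβ.trans hαβ
  have hcost : (H.globalAware L hL (α / β) home T).cost α β =
      α * G.tourLength (L.filter (· ∈ insert home (H.finalLeaders (α / β) T))) +
        β * ∑ t ∈ T, G.dist t (H.destination (α / β) home T t) := by
    rw [← H.throughLength_stops hL.mem, ← Finset.sum_coe_sort T, ← len_through]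
    simp only [Schedule.cost, globalAware, len_shortest]
  have hl2 : 0 < Real.log 2 := Real.log_pos one_lt_two
  have hE0 : 0 ≤ E.cost α β := by
    refine add_nonneg (mul_nonneg hα.le (G.len_nonneg _)) (mul_nonneg hβ.le ?_)
    exact Finset.sum_nonneg fun t _ => G.len_nonneg _
  have hlogn : 0 ≤ Real.log (Fintype.card V) := Real.log_natCast_nonneg _
  have hlogD : 0 ≤ Real.log (1 + G.diam) := Real.log_nonneg (by linarith [G.diam_nonneg])
  have hI := H.one_le_intersection hσ home
  have hI' : (1 : ℝ) ≤ I := by exact_mod_cast hI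
  have hT0 := tourConst_nonneg σ I
  rcases subsingleton_or_nontrivial V with hV | hV
  · have h0 : ∀ x y : V, G.dist x y = 0 := fun x y => by
      rw [Subsingleton.elim x y, dist_self]
    have htour : G.tourLength (L.filter (· ∈ insert home (H.finalLeaders (α / β) T))) ≤ 0 := by
      refine (H.tourLength_filter_le_tspOpt hσ hG hL _).trans (le_of_eq ?_)
      rw [Fintype.card_eq_one_iff_nonempty_unique.2 ⟨⟨⟨home⟩, fun x => Subsingleton.elim _ _⟩⟩]
      simp
    rw [hcost]
    simp only [h0, Finset.sum_const_zero, mul_zero, add_zero]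
    have h1 : 0 ≤ algConst σ I := by unfold algConst; positivity
    have h2 := mul_nonneg hα.le (neg_nonneg.2 htour)
    have h3 : 0 ≤ algConst σ I * (Real.log (Fintype.card V) * Real.log (1 + G.diam)) *
      E.cost α β := by positivity
    linarith
  obtain ⟨x, y, hxy⟩ := exists_pair_ne V
  have hD : 1 ≤ G.diam := (hG x y hxy).trans (G.dist_le_diam x y)
  have hn : (2 : ℝ) ≤ Fintype.card V := by exact_mod_cast Fintype.one_lt_card
  classical
  set meet : V → V := fun t => if h : t ∈ T then E.meet ⟨t, h⟩ else home with hmeetdef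
  have hmeet : ∀ t ∈ T, meet t ∈ E.objWalk.support := fun t ht => by
    simp only [hmeetdef, ht, dif_pos]
    exact E.meet_mem ⟨t, ht⟩
  have hE : α * G.len E.objWalk + β * ∑ t ∈ T, G.dist t (meet t) ≤ E.cost α β := by
    refine add_le_add le_rfl (mul_le_mul_of_nonneg_left ?_ hβ.le)
    rw [← Finset.sum_coe_sort T]
    refine Finset.sum_le_sum fun t _ => ?_
    simp only [hmeetdef, t.2, dif_pos]
    exact G.dist_le_len _
  set B := α * G.len E.objWalk + β * ∑ t ∈ T, G.dist t (meet t) with hB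
  have hB0 : 0 ≤ B := add_nonneg (mul_nonneg hα.le (G.len_nonneg _))
    (mul_nonneg hβ.le (Finset.sum_nonneg fun t _ => G.dist_nonneg _ _))
  have h1 := H.tourLength_filter_le_tspOpt hσ hG hL (insert home (H.finalLeaders (α / β) T))
  have h2 := H.tspOpt_finalLeaders_le hσ hG hD hβ hαβ T E.objWalk meet hmeet
  have h3 := H.sum_dist_destination_le hσ hG hD hβ hαβ T E.objWalk meet hmeet
  rw [← hB] at h2 h3
  set h : ℝ := G.topLevel σ + 1 with hh
  have hh1 : 1 ≤ h := by rw [hh]; linarith [Nat.cast_nonneg (α := ℝ) (G.topLevel σ)]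
  -- Since `h ≥ 1`, the constants `2` and `5` fit into a multiple of `h`, and one `c` serves both
  -- bounds.
  set c : ℝ := 64 * σ ^ 2 * I + 8 * I + 6 with hc
  have hc0 : 0 ≤ c := by positivity
  have h4 : (2 + h * (64 * σ ^ 2 * I + 1)) * B ≤ h * c * B := by
    refine mul_le_mul_of_nonneg_right ?_ hB0
    rw [hc]; nlinarith
  have h5 : (5 + h * (64 * σ ^ 2 * I + 8 * I)) * B ≤ h * c * B := by
    refine mul_le_mul_of_nonneg_right ?_ hB0
    rw [hc]; nlinarith
  have h6 := topLevel_add_one_le G hσ hD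
  have h7 := le_log_of_two_le hn
  set N := Real.log (Fintype.card V)
  set Q := Real.log (1 + G.diam)
  rw [hcost]
  calc _ ≤ α * (tourConst σ I * N * G.tspOpt (insert home (H.finalLeaders (α / β) T))) +
        h * c * B := add_le_add (mul_le_mul_of_nonneg_left h1 hα.le) (h3.trans h5)
    _ = tourConst σ I * N * (α * G.tspOpt (insert home (H.finalLeaders (α / β) T))) +
        1 * (h * c * B) := by ring
    _ ≤ tourConst σ I * N * (h * c * B) + N / Real.log 2 * (h * c * B) := by
      refine add_le_add (mul_le_mul_of_nonneg_left (h2.trans h4) (by positivity))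
        (mul_le_mul_of_nonneg_right h7 (by positivity))
    _ = (tourConst σ I + 1 / Real.log 2) * N * c * (h * B) := by ring
    _ ≤ (tourConst σ I + 1 / Real.log 2) * N * c * (3 * (Q / Real.log 2) * E.cost α β) := by
      refine mul_le_mul_of_nonneg_left ?_ (by positivity)
      exact mul_le_mul h6 hE hB0 (by positivity)
    _ = _ := by rw [algConst, ← hc]; ring

end PartitionHierarchy

end Costs

/-! ### Existence of partition hierarchies. -/

section Existence

variable {V : Type u} (G : WeightedGraph V)

theorem Doubling.mono {G : WeightedGraph V} {δ ε : ℝ} (h : G.Doubling δ) (hle : δ ≤ ε) :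
    G.Doubling ε := fun v r => by
  obtain ⟨s, hs, hcov⟩ := h v r
  exact ⟨s, hs.trans (Real.rpow_le_rpow_of_exponent_le one_le_two hle), hcov⟩

variable [Fintype V]

/-- Ensures that `doublingDim` is an infimum over a nonempty set, not the default value of `sInf`.
-/
theorem exists_doubling : ∃ δ : ℝ, G.Doubling δ := by
  obtain ⟨k, hk⟩ := pow_unbounded_of_one_lt ((Finset.univ : Finset V).card : ℝ) one_lt_two
  refine ⟨k, fun v r => ?_⟩
  rcases le_total 0 r with hr | hr
  · refine ⟨Finset.univ, by rw [Real.rpow_natCast]; exact hk.le, fun x _ => ?_⟩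
    simp only [Set.mem_iUnion]
    exact ⟨x, Finset.mem_univ x, by simp [nbhd]; linarith⟩
  · refine ⟨{v}, ?_, fun x hx => ?_⟩
    · rw [Real.rpow_natCast]
      simpa using one_le_pow₀ one_le_two
    · have h1 : G.dist v x ≤ r := hx
      have h2 := G.dist_nonneg v x
      have h3 : r = 0 := by linarith
      subst h3
      simpa [nbhd] using h1

theorem doubling_of_doublingDim_lt {δ : ℝ} (h : G.doublingDim < δ) : G.Doubling δ := by
  obtain ⟨ε, hε, hlt⟩ := exists_lt_of_csInf_lt G.exists_doubling h
  exact Doubling.mono hε hlt.le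

/-- In a graph of low doubling dimension, a ball holds few points that are far from each other. -/
theorem card_le_of_separated {δ r : ℝ} (h : G.Doubling δ) (v : V) (N : Finset V)
    (hN : ∀ x ∈ N, ∀ y ∈ N, x ≠ y → r < G.dist x y) (hv : ∀ x ∈ N, G.dist v x ≤ 2 * r) :
    (N.card : ℝ) ≤ (2 : ℝ) ^ δ * (2 : ℝ) ^ δ := by
  classical
  obtain ⟨s, hs, hcov⟩ := h v (2 * r)
  -- Halving twice covers the `2 r`-ball by balls of radius `r / 2`, each of which holds at most one
  -- point of `N`.
  choose s' hs' hcov' using fun c : V => h c r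
  have hmem : ∀ x ∈ N, ∃ c ∈ s.biUnion s', G.dist c x ≤ r / 2 := by
    intro x hx
    have h1 := hcov (hv x hx)
    simp only [Set.mem_iUnion] at h1
    obtain ⟨c, hc, hcx⟩ := h1
    have hcx' : G.dist c x ≤ 2 * r / 2 := hcx
    have h2 := hcov' c (show G.dist c x ≤ r by linarith)
    simp only [Set.mem_iUnion] at h2
    obtain ⟨b, hb, hbx⟩ := h2
    exact ⟨b, Finset.mem_biUnion.2 ⟨c, hc, hb⟩, hbx⟩
  choose! f hf hfd using hmem
  have hcard : N.card ≤ (s.biUnion s').card := by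
    refine Finset.card_le_card_of_injOn f hf ?_
    intro x hx y hy hxy
    by_contra hne
    have h1 := hfd x hx
    have h2 := hfd y hy
    rw [← hxy] at h2
    rw [G.dist_comm] at h1
    linarith [hN x hx y hy hne, G.dist_triangle x (f x) y]
  have h1 : (N.card : ℝ) ≤ ∑ c ∈ s, ((s' c).card : ℝ) := by
    exact_mod_cast hcard.trans Finset.card_biUnion_le
  refine h1.trans ((Finset.sum_le_sum fun c _ => hs' c).trans ?_)
  rw [Finset.sum_const, nsmul_eq_mul]
  exact mul_le_mul_of_nonneg_right hs (by positivity)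

/-- There is a maximal set of nodes with pairwise distances larger than `r`. -/
theorem exists_net {r : ℝ} (hr : 0 ≤ r) : ∃ N : Finset V,
    (∀ x ∈ N, ∀ y ∈ N, x ≠ y → r < G.dist x y) ∧ ∀ v, ∃ x ∈ N, G.dist x v ≤ r := by
  classical
  let P : Finset (Finset V) := Finset.univ.filter fun N =>
    ∀ x ∈ N, ∀ y ∈ N, x ≠ y → r < G.dist x y
  obtain ⟨N, hN, hmax⟩ := Finset.exists_max_image P Finset.card ⟨∅, by simp [P]⟩
  have hsep := (Finset.mem_filter.1 hN).2
  refine ⟨N, hsep, fun v => ?_⟩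
  by_contra hcon
  push Not at hcon
  have hv : v ∉ N := fun h => by
    have := hcon v h
    rw [dist_self] at this
    linarith
  have hins : insert v N ∈ P := by
    refine Finset.mem_filter.2 ⟨Finset.mem_univ _, ?_⟩
    intro x hx y hy hxy
    rcases Finset.mem_insert.1 hx with rfl | hx' <;> rcases Finset.mem_insert.1 hy with rfl | hy'
    · exact absurd rfl hxy
    · rw [G.dist_comm]; exact hcon y hy'
    · exact hcon x hx'
    · exact hsep x hx' y hy' hxy
  have := hmax _ hins
  rw [Finset.card_insert_of_notMem hv] at this
  omega

variable [DecidableEq V]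

/-- The partition of the nodes into the fibres of a map. -/
def fibrePartition (f : V → V) : Finpartition (Finset.univ : Finset V) :=
  Finpartition.ofSetoid (Setoid.ker f)

theorem mem_fibrePartition_parts {f : V → V} {X : Finset V} (hX : X ∈ (fibrePartition f).parts) :
    ∃ z, X = Finset.univ.filter fun x => f z = f x := by
  obtain ⟨z, hz⟩ := Finset.nonempty_iff_ne_empty.2 (Finpartition.ne_bot _ hX)
  refine ⟨z, ?_⟩
  rw [← Finpartition.part_eq_of_mem _ hX hz]
  ext x
  rw [fibrePartition, Finpartition.mem_part_ofSetoid_iff_rel, Setoid.ker_def]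
  simp

/-- Each node joins a point of a maximal `r`-separated set within distance `r`, so clusters have
diameter at most `2 r`. A cluster that meets the `r`-ball of `v` has its net point within `2 r` of
`v`, and there are few of these. -/
theorem exists_sparsePartition {δ r : ℝ} (h : G.Doubling δ) (hr : 0 ≤ r) {I : ℕ}
    (hI : (2 : ℝ) ^ δ * (2 : ℝ) ^ δ ≤ I) :
    ∃ P : Finpartition (Finset.univ : Finset V), G.IsSparsePartition P r 2 I := by
  obtain ⟨N, hsep, hcov⟩ := G.exists_net hr
  choose f hfN hf using hcov
  refine ⟨fibrePartition f, ?_, fun v => ?_⟩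
  · intro X hX u hu v hv
    obtain ⟨z, rfl⟩ := mem_fibrePartition_parts hX
    have hfu := (Finset.mem_filter.1 hu).2
    have hfv := (Finset.mem_filter.1 hv).2
    have h1 := hf u
    have h2 := hf v
    rw [← hfu, G.dist_comm] at h1
    rw [← hfv] at h2
    linarith [G.dist_triangle u (f z) v]
  · have h1 := G.card_le_of_separated h v (N.filter fun c => G.dist v c ≤ 2 * r)
      (fun x hx y hy => hsep x (Finset.mem_filter.1 hx).1 y (Finset.mem_filter.1 hy).1)
      fun x hx => (Finset.mem_filter.1 hx).2
    have h2 : (N.filter fun c => G.dist v c ≤ 2 * r).card ≤ I := by exact_mod_cast h1.trans hI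
    refine le_trans ?_ (Finset.card_image_le.trans h2 :
      ((N.filter fun c => G.dist v c ≤ 2 * r).image
        fun c => Finset.univ.filter fun x => c = f x).card ≤ I)
    rw [← Set.ncard_coe_finset]
    refine Set.ncard_le_ncard ?_ (Set.toFinite _)
    rintro X ⟨hX, x, hxX, hxv⟩
    obtain ⟨z, rfl⟩ := mem_fibrePartition_parts hX
    have hzx := (Finset.mem_filter.1 (Finset.mem_coe.1 hxX)).2
    have hvx : G.dist v x ≤ r := hxv
    refine Finset.mem_coe.2 (Finset.mem_image.2 ⟨f z, Finset.mem_filter.2 ⟨hfN z, ?_⟩, rfl⟩)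
    rw [hzx]
    linarith [G.dist_triangle v x (f x), hf x, G.dist_comm (f x) x]

theorem exists_partitionHierarchy {δ : ℝ} (h : G.Doubling δ) {I : ℕ} (hI1 : 1 ≤ I)
    (hI : (2 : ℝ) ^ δ * (2 : ℝ) ^ δ ≤ I) : Nonempty (G.PartitionHierarchy 2 I) := by
  have hV : Nonempty V := G.connected.nonempty
  choose P hP using fun l : ℕ =>
    G.exists_sparsePartition h (G.radius_nonneg (σ := 2) one_le_two l) hI
  have huniv : (Finset.univ : Finset V) ≠ ⊥ := Finset.univ_nonempty.ne_empty
  refine ⟨{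
    -- The top level must be a single cluster; this is sparse because the radius there equals the
    -- diameter.
    part := fun l => if l < G.topLevel 2 then P l else Finpartition.indiscrete huniv
    leader := fun _ X => if hX : X.Nonempty then hX.choose else Classical.arbitrary V
    sparse := fun l hl => ?_
    top := by simp
    leader_mem := fun l _ X hX => ?_ }⟩
  · split_ifs with hlt
    · exact hP l
    · have hlt' : l = G.topLevel 2 := le_antisymm hl (not_lt.1 hlt)
      have hrad : G.radius 2 l = G.diam := by
        rw [radius, hlt']
        exact min_eq_left (G.diam_le_pow_topLevel one_le_two)
      refine ⟨fun X _ u _ v _ => ?_, fun v => ?_⟩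
      · rw [hrad]
        linarith [G.dist_le_diam u v, G.diam_nonneg]
      · refine le_trans (Set.ncard_le_ncard (t := {Finset.univ}) ?_ (Set.toFinite _)) ?_
        · rintro X ⟨hX, -⟩
          simpa using hX
        · simpa using hI1
  · have hne : X.Nonempty := Finset.nonempty_iff_ne_empty.2 (Finpartition.ne_bot _ hX)
    rw [dif_pos hne]
    exact hne.choose_spec

end Existence

/-! ### Existence of universal tours. -/

namespace PartitionHierarchy

variable {V : Type u} {G : WeightedGraph V} [Fintype V] [DecidableEq V] {σ : ℝ} {I : ℕ}
  (H : G.PartitionHierarchy σ I)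

/-- The numbers of the ancestors of a node in the levels `l, …, l + k`, read as the digits of a
number in base `N`. -/
def ancestorCode (N : ℕ) (e : Finset V → ℕ) : ℕ → ℕ → V → ℕ
  | 0, l, v => e (H.ancestor l v)
  | k + 1, l, v => ancestorCode N e k (l + 1) v * N + e (H.ancestor l v)

theorem ancestorCode_eq (N : ℕ) (e : Finset V → ℕ) {a c : V} (k : ℕ) : ∀ l : ℕ,
    H.ancestor l a = H.ancestor l c → H.ancestorCode N e k l a = H.ancestorCode N e k l c := by
  induction k with
  | zero => intro l h; simp only [ancestorCode, h]
  | succ k ih =>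
    intro l h
    simp only [ancestorCode, h, ih (l + 1) (H.ancestor_eq_of_le (Nat.le_succ l) h)]

/-- Higher levels are more significant digits, and dropping the lowest digit preserves the order. As
an ancestor determines all those above it, equal ancestors at level `m` mean equal digits from `m`
on, so a code between two such codes has these digits as well. -/
theorem ancestorCode_between {N : ℕ} {e : Finset V → ℕ} (he : Function.Injective e)
    (hN : ∀ X, e X < N) {a b c : V} (k : ℕ) : ∀ l m : ℕ, l ≤ m → m ≤ l + k →
      H.ancestorCode N e k l a ≤ H.ancestorCode N e k l b →
      H.ancestorCode N e k l b ≤ H.ancestorCode N e k l c →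
      H.ancestor m a = H.ancestor m c → H.ancestor m b = H.ancestor m a := by
  induction k with
  | zero =>
    intro l m hlm hml hab hbc hac
    obtain rfl : m = l := by omega
    simp only [ancestorCode] at hab hbc
    rw [← hac] at hbc
    exact he (le_antisymm hbc hab)
  | succ k ih =>
    intro l m hlm hml hab hbc hac
    have key : ∀ x y : V, H.ancestorCode N e (k + 1) l x ≤ H.ancestorCode N e (k + 1) l y →
        H.ancestorCode N e k (l + 1) x ≤ H.ancestorCode N e k (l + 1) y := by
      intro x y hxy
      simp only [ancestorCode] at hxy
      by_contra hcon
      have h1 := Nat.mul_le_mul_right N (Nat.succ_le_of_lt (not_le.1 hcon))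
      rw [Nat.succ_mul] at h1
      have h2 := hN (H.ancestor l y)
      omega
    rcases hlm.eq_or_lt with rfl | hlt
    · have h1 := H.ancestorCode_eq N e k (l + 1) (H.ancestor_eq_of_le (Nat.le_succ l) hac)
      have h2 := key _ _ hab
      have h3 := key _ _ hbc
      rw [← h1] at h3
      simp only [ancestorCode, ← h1, le_antisymm h3 h2, ← hac] at hab hbc
      exact he (le_antisymm (by omega) (by omega))
    · exact ih (l + 1) m hlt (by omega) (key _ _ hab) (key _ _ hbc) hac

theorem exists_isUniversalTour : ∃ L : List V, H.IsUniversalTour L := by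
  set N := Fintype.card (Finset V)
  set e : Finset V → ℕ := fun X => Fintype.equivFin (Finset V) X
  have he : Function.Injective e :=
    Fin.val_injective.comp (Fintype.equivFin (Finset V)).injective
  have hN : ∀ X, e X < N := fun X => (Fintype.equivFin (Finset V) X).2
  set key := H.ancestorCode N e (G.topLevel σ) 0
  set L := (Finset.univ : Finset V).toList.mergeSort (fun a b => decide (key a ≤ key b))
  have hperm : L.Perm (Finset.univ : Finset V).toList := List.mergeSort_perm _ _
  have hsort : L.Pairwise fun a b => key a ≤ key b := by
    have := List.pairwise_mergeSort (le := fun a b => decide (key a ≤ key b))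
      (fun a b c hab hbc => by
        simp only [decide_eq_true_eq] at hab hbc ⊢
        exact hab.trans hbc)
      (fun a b => by simpa using le_total (key a) (key b)) (Finset.univ : Finset V).toList
    simpa using this
  refine ⟨L, hperm.nodup_iff.2 (Finset.nodup_toList _), fun v => ?_, ?_⟩
  · exact hperm.mem_iff.2 (by simp)
  · intro l hl a b c habc hac
    have h := hsort.sublist habc
    simp only [List.pairwise_cons, List.mem_cons] at h
    exact H.ancestorCode_between he hN (G.topLevel σ) 0 l (Nat.zero_le l) (by omega)
      (h.1 b (by simp)) (h.2.1 c (by simp)) hac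

end PartitionHierarchy

end WeightedGraph

end

/-! ### The main theorem. -/

theorem mainTheorem3 (δ : ℝ) :
    (∃ (σ : ℝ) (I : ℕ), 1 ≤ σ ∧
      ∀ (V : Type u) [Fintype V] [DecidableEq V] (G : WeightedGraph V),
        (∀ x y : V, x ≠ y → 1 ≤ G.dist x y) → G.doublingDim ≤ δ →
        Nonempty (G.PartitionHierarchy σ I)) ∧
    ∀ (σ : ℝ) (I : ℕ), 1 ≤ σ →
      ∃ C : ℝ, 0 < C ∧
        ∀ (V : Type u) [Fintype V] [DecidableEq V] (G : WeightedGraph V),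
          (∀ x y : V, x ≠ y → 1 ≤ G.dist x y) → G.doublingDim ≤ δ →
          ∀ H : G.PartitionHierarchy σ I,
            (∃ L : List V, H.IsUniversalTour L) ∧
            ∀ (L : List V) (hL : H.IsUniversalTour L),
              (∀ S : Finset V, G.tourLength (L.filter (· ∈ S)) ≤
                C * Real.log (Fintype.card V) * G.tspOpt S) ∧
              ∀ (α β : ℝ), 0 < β → β < α → ∀ (home : V) (T : Finset V),
                (H.globalAware L hL (α / β) home T).cost α β ≤
                  C * (Real.log (Fintype.card V) * Real.log (1 + G.diam)) *
                    G.optCost home T α β := by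
  -- With `δ + 1` the bound on `doublingDim` becomes strict, so the infimum need not be attained.
  refine ⟨⟨2, max 1 ⌈(2 : ℝ) ^ (δ + 1) * (2 : ℝ) ^ (δ + 1)⌉₊, one_le_two, ?_⟩, ?_⟩
  · intro V _ _ G _ hδ
    refine G.exists_partitionHierarchy (G.doubling_of_doublingDim_lt (hδ.trans_lt (lt_add_one δ)))
      (le_max_left _ _) ((Nat.le_ceil _).trans ?_)
    exact_mod_cast le_max_right _ _
  · intro σ I hσ
    have h1 := WeightedGraph.PartitionHierarchy.tourConst_nonneg σ I
    have h2 : 0 ≤ WeightedGraph.PartitionHierarchy.algConst σ I := by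
      have := Real.log_pos one_lt_two
      unfold WeightedGraph.PartitionHierarchy.algConst
      positivity
    refine ⟨WeightedGraph.PartitionHierarchy.tourConst σ I +
      WeightedGraph.PartitionHierarchy.algConst σ I + 1, by linarith, ?_⟩
    intro V _ _ G hG _ H
    refine ⟨H.exists_isUniversalTour, fun L hL => ⟨fun S => ?_, fun α β hβ hαβ home T => ?_⟩⟩
    · refine (H.tourLength_filter_le_tspOpt hσ hG hL S).trans ?_
      have h3 : 0 ≤ G.tspOpt S := Real.iInf_nonneg fun l => G.tourLength_nonneg l.1
      have h4 : 0 ≤ Real.log (Fintype.card V) := Real.log_natCast_nonneg _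
      gcongr
      linarith
    · have h4 : 0 ≤ Real.log (Fintype.card V) := Real.log_natCast_nonneg _
      have h5 : 0 ≤ Real.log (1 + G.diam) := Real.log_nonneg (by linarith [G.diam_nonneg])
      have : Nonempty (G.Schedule home T) := ⟨H.globalAware L hL (α / β) home T⟩
      rw [WeightedGraph.optCost, Real.mul_iInf_of_nonneg (by positivity)]
      refine le_ciInf fun E => (H.cost_globalAware_le hσ hG hL hβ hαβ home T E).trans ?_
      have h6 : 0 ≤ E.cost α β := by
        refine add_nonneg (mul_nonneg (hβ.trans hαβ).le (G.len_nonneg _)) (mul_nonneg hβ.le ?_)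
        exact Finset.sum_nonneg fun t _ => G.len_nonneg _
      gcongr
      linarith
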